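/- **Theorem 5.5.** Let $\mu,\lambda$ be finite, positive (regular) Borel measures on the unit circle $\partial\mathbb D$. For such a measure $\mu$ let $H^2(\mu)$ be the closure of the analytic polynomials in $L^2(\mu)$, let $Z^\mu$ be multiplication by $\zeta$ on $H^2(\mu)$, let $(\mathscr C_\mu h)(z)=\int_{\partial\mathbb D}\frac{h(\zeta)}{1-z\overline\zeta}\,\mu(d\zeta)$, $z\in\mathbb D$, be the Cauchy transform of $h\in H^2(\mu)$, and let $\mathscr H^+(\mu)=\mathscr C_\mu H^2(\mu)$, a Hilbert space of functions on $\mathbb D$ with the inner product $\langle \mathscr C_\mu g,\mathscr C_\mu h\rangle_\mu=\langle g,h\rangle_{L^2(\mu)}$ (the map $\mathscr C_\mu$ is injective on $H^2(\mu)$). Put $V_\mu=\mathscr C_\mu Z^\mu\mathscr C_\mu^*$ and $\mathrm{int}(\mu,\lambda)=\mathscr H^+(\mu)\cap\mathscr H^+(\lambda)$. A linear subspace of $\mathscr H^+(\mu)$, closed or not, is called $V_\mu$-reducing if it is invariant under $V_\mu$ and $V_\mu^*$. We say that $\mu$ is RK-absolutely continuous with respect to $\lambda$ if $\mathrm{int}(\mu,\lambda)$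 is norm-dense in $\mathscr H^+(\mu)$, and RK-singular with respect to $\lambda$ if $\mathrm{int}(\mu,\lambda)=\{0\}$. The measure $\lambda$ is extreme if $b_\lambda=\frac{H_\lambda-1}{H_\lambda+1}$, where $H_\lambda(z)=\int_{\partial\mathbb D}\frac{1+z\overline\zeta}{1-z\overline\zeta}\,\lambda(d\zeta)$, is an extreme point of the convex set of analytic functions on $\mathbb D$ bounded by $1$ in modulus, and non-extreme otherwise. (a) If $\lambda$ is non-extreme, then $\mathrm{int}(\mu,\lambda)$ is $V_\mu$-reducing. (b) Suppose that $\mathrm{int}(\mu,\lambda)$ is $V_\mu$-reducing, and let $\mu=\mu_{ac}+\mu_s$ be the Lebesgue decomposition of $\mu$ with respect to $\lambda$. Then $\mathscr H^+(\mu_{ac})$ and $\mathscr H^+(\mu_s)$ are isometrically contained in $\mathscr H^+(\mu)$, and $\mathscr H^+(\mu)$ is their orthogonal direct sum, $$\mathscr H^+(\mu)=\mathscr H^+(\mu_{ac})\oplus\mathscr H^+(\mu_s).$$ Moreover $\mathscr H^+(\mu_{ac})$ is the closure of $\mathrm{int}(\mu,\lambda)$ in the norm of $\mathscr H^+(\mu)$,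 and $\mathscr H^+(\mu_s)\cap\mathscr H^+(\lambda)=\{0\}$. That is, $\mu_{ac}$ is the largest positive measure $\gamma\le\mu$ which is RK-absolutely continuous with respect to $\lambda$, and $\mu_s$ is RK-singular with respect to $\lambda$. -/

import Mathlib

open MeasureTheory Polynomial
open scoped ComplexConjugate ENNReal InnerProductSpace Complex.UnitDisc

noncomputable section

/-- The unit circle carries its Borel `σ`-algebra. -/
instance Circle.instMeasurableSpaceBorel : MeasurableSpace Circle := borel Circle

instance Circle.instBorelSpaceBorel : BorelSpace Circle := ⟨rfl⟩

namespace CauchyTransform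

theorem continuous_circle_coe : Continuous (fun ζ : Circle => (ζ : ℂ)) := continuous_subtype_val

/-! ### The Hardy space `H²(μ)` -/

/-- The independent variable `ζ` as a continuous function on the circle. -/
def zeta : C(Circle, ℂ) := ⟨fun ζ => (ζ : ℂ), continuous_circle_coe⟩

theorem zeta_apply (ζ : Circle) : zeta ζ = (ζ : ℂ) := rfl

/-- An analytic polynomial, as an element of `L²(μ)`. -/
def polyLp (μ : Measure Circle) [IsFiniteMeasure μ] : ℂ[X] →ₗ[ℂ] Lp ℂ 2 μ :=
  (ContinuousMap.toLp 2 μ ℂ).toLinearMap ∘ₗ (Polynomial.aeval zeta).toLinearMap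

/-- `H²(μ)`: the closure of the analytic polynomials in `L²(μ)`. -/
def H2 (μ : Measure Circle) [IsFiniteMeasure μ] : Submodule ℂ (Lp ℂ 2 μ) :=
  (LinearMap.range (polyLp μ)).topologicalClosure

instance instCompleteSpaceH2 (μ : Measure Circle) [IsFiniteMeasure μ] : CompleteSpace (H2 μ) :=
  (Submodule.isClosed_topologicalClosure _).completeSpace_coe

theorem memLp_zeta_mul {μ : Measure Circle} (h : Lp ℂ 2 μ) :
    MemLp (fun ζ : Circle => (ζ : ℂ) * h ζ) 2 μ := by
  have h1 : AEStronglyMeasurable (fun ζ : Circle => (ζ : ℂ)) μ :=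
    continuous_circle_coe.aestronglyMeasurable
  refine (Lp.memLp h).of_le (h1.mul (Lp.aestronglyMeasurable h)) ?_
  exact Filter.Eventually.of_forall fun ζ => by simp [Circle.norm_coe]

/-- Multiplication by the independent variable, `(M_ζ h)(ζ) = ζ h(ζ)`, on `L²(μ)`. -/
def mulZeta (μ : Measure Circle) : Lp ℂ 2 μ →ₗᵢ[ℂ] Lp ℂ 2 μ where
  toFun h := (memLp_zeta_mul h).toLp _
  map_add' f g := by
    rw [← MemLp.toLp_add]
    refine MemLp.toLp_congr _ _ ?_
    filter_upwards [Lp.coeFn_add f g] with ζ hζ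
    rw [hζ, Pi.add_apply, Pi.add_apply, mul_add]
  map_smul' c f := by
    rw [RingHom.id_apply, ← MemLp.toLp_const_smul]
    refine MemLp.toLp_congr _ _ ?_
    filter_upwards [Lp.coeFn_smul c f] with ζ hζ
    simp only [hζ, Pi.smul_apply, smul_eq_mul]
    ring
  norm_map' f := by
    change ‖(memLp_zeta_mul f).toLp _‖ = ‖f‖
    rw [Lp.norm_toLp, Lp.norm_def]
    congr 1
    exact eLpNorm_congr_norm_ae (Filter.Eventually.of_forall fun ζ => by simp [Circle.norm_coe])

theorem mulZeta_polyLp (μ : Measure Circle) [IsFiniteMeasure μ] (p : ℂ[X]) :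
    mulZeta μ (polyLp μ p) = polyLp μ (X * p) := by
  apply Lp.ext
  have h1 : mulZeta μ (polyLp μ p) =ᵐ[μ] fun ζ : Circle => (ζ : ℂ) * polyLp μ p ζ :=
    MemLp.coeFn_toLp (memLp_zeta_mul (polyLp μ p))
  have h2 : polyLp μ p =ᵐ[μ] Polynomial.aeval zeta p :=
    ContinuousMap.coeFn_toLp (𝕜 := ℂ) μ _
  have h3 : polyLp μ (X * p) =ᵐ[μ] Polynomial.aeval zeta (X * p) :=
    ContinuousMap.coeFn_toLp (𝕜 := ℂ) μ _
  filter_upwards [h1, h2, h3] with ζ e1 e2 e3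
  rw [e1, e2, e3]
  simp [zeta_apply]

theorem mulZeta_mem_H2 (μ : Measure Circle) [IsFiniteMeasure μ] {h : Lp ℂ 2 μ} (hh : h ∈ H2 μ) :
    mulZeta μ h ∈ H2 μ := by
  refine map_mem_closure (mulZeta μ).continuous hh ?_
  rintro _ ⟨p, rfl⟩
  exact ⟨X * p, (mulZeta_polyLp μ p).symm⟩

/-- `Z^μ`: the restriction of `M_ζ` to `H²(μ)`. -/
def Z (μ : Measure Circle) [IsFiniteMeasure μ] : H2 μ →L[ℂ] H2 μ :=
  ((mulZeta μ).toContinuousLinearMap ∘L (H2 μ).subtypeL).codRestrict (H2 μ)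
    fun h => mulZeta_mem_H2 μ h.2

/-! ### Cauchy transforms -/

theorem one_sub_conj_mul_ne_zero (z : 𝔻) (ζ : Circle) : 1 - conj (z : ℂ) * (ζ : ℂ) ≠ 0 := by
  intro h
  have h1 : ‖conj (z : ℂ) * (ζ : ℂ)‖ = 1 := by rw [← sub_eq_zero.mp h, norm_one]
  rw [norm_mul, RCLike.norm_conj, Circle.norm_coe, mul_one] at h1
  exact z.norm_ne_one h1

/-- The Szegő kernel vector `k_z(ζ) = (1 - z̄ ζ)⁻¹`. -/
def szego (z : 𝔻) : C(Circle, ℂ) :=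
  ⟨fun ζ => (1 - conj (z : ℂ) * (ζ : ℂ))⁻¹,
    (continuous_const.sub (continuous_const.mul continuous_circle_coe)).inv₀
      (one_sub_conj_mul_ne_zero z)⟩

theorem szego_apply (z : 𝔻) (ζ : Circle) : szego z ζ = (1 - conj (z : ℂ) * (ζ : ℂ))⁻¹ := rfl

/-- `(𝒞_μ h)(z) = ∫ h(ζ) / (1 - z ζ̄) μ(dζ)`. -/
def cauchyFun (μ : Measure Circle) (h : Circle → ℂ) (z : 𝔻) : ℂ :=
  ∫ ζ : Circle, h ζ / (1 - (z : ℂ) * conj (ζ : ℂ)) ∂μ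

theorem cauchyFun_eq_inner (μ : Measure Circle) [IsFiniteMeasure μ] (h : Lp ℂ 2 μ) (z : 𝔻) :
    cauchyFun μ h z = ⟪ContinuousMap.toLp 2 μ ℂ (szego z), h⟫_ℂ := by
  rw [L2.inner_def]
  refine integral_congr_ae ?_
  filter_upwards [ContinuousMap.coeFn_toLp (p := 2) (𝕜 := ℂ) μ (szego z)] with ζ hζ
  rw [hζ]
  simp [szego_apply, div_eq_mul_inv]

/-- The `μ`-Cauchy transform on `H²(μ)`. -/
def cauchy (μ : Measure Circle) [IsFiniteMeasure μ] : H2 μ →ₗ[ℂ] (𝔻 → ℂ) where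
  toFun h := cauchyFun μ (h : Lp ℂ 2 μ)
  map_add' f g := by
    ext z
    simp only [Pi.add_apply, cauchyFun_eq_inner, Submodule.coe_add, inner_add_right]
  map_smul' c f := by
    ext z
    simp only [Pi.smul_apply, cauchyFun_eq_inner, Submodule.coe_smul, inner_smul_right,
      RingHom.id_apply, smul_eq_mul]

theorem hasSum_szego (z : 𝔻) :
    HasSum (fun n : ℕ => conj (z : ℂ) ^ n • zeta ^ n) (szego z) := by
  have hz : ‖conj (z : ℂ)‖ < 1 := by rw [RCLike.norm_conj]; exact z.norm_lt_one
  have hs : Summable (fun n : ℕ => conj (z : ℂ) ^ n • zeta ^ n) := by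
    refine Summable.of_norm_bounded (summable_geometric_of_lt_one (norm_nonneg _) hz) fun n => ?_
    refine (ContinuousMap.norm_le _ (by positivity)).2 fun ζ => ?_
    simp [zeta_apply, Circle.norm_coe]
  refine hs.hasSum_iff.2 ?_
  ext ζ
  refine (ContinuousMap.tsum_apply hs ζ).symm.trans ?_
  have h1 : ‖conj (z : ℂ) * (ζ : ℂ)‖ < 1 := by simpa [Circle.norm_coe] using z.norm_lt_one
  simpa [szego_apply, zeta_apply, mul_pow] using tsum_geometric_of_norm_lt_one h1

theorem cauchy_injective (μ : Measure Circle) [IsFiniteMeasure μ] :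
    Function.Injective (cauchy μ) := by
  rw [injective_iff_map_eq_zero]
  intro h hh
  set a : ℕ → ℂ := fun n => ⟪polyLp μ (X ^ n), (h : Lp ℂ 2 μ)⟫_ℂ with ha
  have hsum : ∀ z : 𝔻, HasSum (fun n => (z : ℂ) ^ n * a n) 0 := by
    intro z
    have h0 : ⟪ContinuousMap.toLp 2 μ ℂ (szego z), (h : Lp ℂ 2 μ)⟫_ℂ = 0 := by
      rw [← cauchyFun_eq_inner]
      exact congrFun hh z
    have h1 := (hasSum_szego z).mapL (ContinuousMap.toLp 2 μ ℂ)
    have h2 := h1.mapL (innerSL ℂ (h : Lp ℂ 2 μ))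
    have h3 := h2.star
    simp only [innerSL_apply_apply, map_smul, smul_eq_mul] at h3
    have h4 : star ⟪(h : Lp ℂ 2 μ), ContinuousMap.toLp 2 μ ℂ (szego z)⟫_ℂ = 0 := by
      rw [← h0]; exact inner_conj_symm _ _
    rw [h4] at h3
    have h5 : (fun n => star (conj (z : ℂ) ^ n *
        ⟪(h : Lp ℂ 2 μ), ContinuousMap.toLp 2 μ ℂ (zeta ^ n)⟫_ℂ)) =
        fun n => (z : ℂ) ^ n * a n := by
      funext n
      have h6 : star ⟪(h : Lp ℂ 2 μ), ContinuousMap.toLp 2 μ ℂ (zeta ^ n)⟫_ℂ = a n := by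
        change conj _ = _
        rw [inner_conj_symm]
        simp [ha, polyLp]
      rw [star_mul', h6]
      simp
    rw [h5] at h3
    exact h3
  have hp : HasFPowerSeriesAt (0 : ℂ → ℂ) (FormalMultilinearSeries.ofScalars ℂ a) 0 := by
    rw [hasFPowerSeriesAt_iff]
    filter_upwards [Metric.ball_mem_nhds (0 : ℂ) one_pos] with z hz
    have := hsum ⟨z, hz⟩
    simp only [FormalMultilinearSeries.coeff_ofScalars, smul_eq_mul, Pi.zero_apply]
    exact this
  have ha0 : ∀ n, a n = 0 := by
    intro n
    have := congrArg (fun p => FormalMultilinearSeries.coeff p n) hp.eq_zero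
    simp only [FormalMultilinearSeries.coeff_ofScalars] at this
    rw [this]
    rfl
  have horth : ∀ p : ℂ[X], ⟪polyLp μ p, (h : Lp ℂ 2 μ)⟫_ℂ = 0 := by
    intro p
    induction p using Polynomial.induction_on' with
    | add p q hp hq => rw [map_add, inner_add_left, hp, hq, add_zero]
    | monomial n c =>
      rw [← Polynomial.smul_X_eq_monomial, map_smul, inner_smul_left]
      have := ha0 n
      simp only [ha] at this
      rw [this, mul_zero]
  have hmem : (h : Lp ℂ 2 μ) ∈ (LinearMap.range (polyLp μ))ᗮ := by
    rw [Submodule.mem_orthogonal]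
    rintro _ ⟨p, rfl⟩
    exact horth p
  rw [← Submodule.orthogonal_closure] at hmem
  have h5 : ⟪(h : Lp ℂ 2 μ), (h : Lp ℂ 2 μ)⟫_ℂ = 0 :=
    (Submodule.mem_orthogonal _ _).1 hmem _ h.2
  exact Subtype.ext (inner_self_eq_zero.1 h5)

/-! ### The space of `μ`-Cauchy transforms -/

/-- `ℋ⁺(μ) = 𝒞_μ H²(μ)`, a vector space of functions on the disk. It is a type of its own, rather
than a subspace, because its norm (below) does not induce the topology of pointwise convergence. -/
def HPlus (μ : Measure Circle) [IsFiniteMeasure μ] : Type := LinearMap.range (cauchy μ)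

section HPlus

variable (μ : Measure Circle) [IsFiniteMeasure μ]

instance : AddCommGroup (HPlus μ) := inferInstanceAs (AddCommGroup (LinearMap.range (cauchy μ)))

instance : Module ℂ (HPlus μ) := inferInstanceAs (Module ℂ (LinearMap.range (cauchy μ)))

/-- The inclusion of `ℋ⁺(μ)` into all functions on the disk. -/
def HPlus.toFunₗ : HPlus μ →ₗ[ℂ] (𝔻 → ℂ) := (LinearMap.range (cauchy μ)).subtype

/-- The Cauchy transform as a linear bijection of `H²(μ)` onto `ℋ⁺(μ)`. -/
def cauchyEquiv : H2 μ ≃ₗ[ℂ] HPlus μ := LinearEquiv.ofInjective (cauchy μ) (cauchy_injective μ)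

/-- The norm of `ℋ⁺(μ)`: `‖𝒞_μ g‖ = ‖g‖` in `L²(μ)`. -/
instance : NormedAddCommGroup (HPlus μ) :=
  NormedAddCommGroup.induced (HPlus μ) (H2 μ) (cauchyEquiv μ).symm (cauchyEquiv μ).symm.injective

/-- The inner product of `ℋ⁺(μ)`: `⟪𝒞_μ g, 𝒞_μ h⟫ = ⟪g, h⟫` in `L²(μ)`. -/
instance : InnerProductSpace ℂ (HPlus μ) := InnerProductSpace.induced (cauchyEquiv μ).symm

/-- The Cauchy transform `𝒞_μ` as a unitary of `H²(μ)` onto `ℋ⁺(μ)`. -/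
def cauchyU : H2 μ ≃ₗᵢ[ℂ] HPlus μ :=
  { cauchyEquiv μ with
    norm_map' := fun h => by
      change ‖(cauchyEquiv μ).symm (cauchyEquiv μ h)‖ = ‖h‖
      rw [LinearEquiv.symm_apply_apply] }

instance : CompleteSpace (HPlus μ) :=
  ((cauchyU μ).toIsometryEquiv.completeSpace_iff).1 inferInstance

/-- `ℋ⁺(μ)` is a reproducing kernel Hilbert space of functions on the disk. -/
instance : RKHS ℂ (HPlus μ) 𝔻 ℂ where
  coeCLM :=
    { HPlus.toFunₗ μ with
      cont := by
        refine continuous_pi fun z => ?_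
        have : (fun f : HPlus μ => HPlus.toFunₗ μ f z) = fun f : HPlus μ =>
            ⟪ContinuousMap.toLp 2 μ ℂ (szego z), (((cauchyU μ).symm f : H2 μ) : Lp ℂ 2 μ)⟫_ℂ := by
          funext f
          obtain ⟨g, rfl⟩ := (cauchyU μ).surjective f
          rw [LinearIsometryEquiv.symm_apply_apply, ← cauchyFun_eq_inner]
          rfl
        change Continuous (fun f : HPlus μ => HPlus.toFunₗ μ f z)
        rw [this]
        exact (innerSL ℂ _).continuous.comp
          (continuous_subtype_val.comp (cauchyU μ).symm.continuous) }
  coeCLM_injective := Subtype.val_injective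

theorem cauchyU_apply (h : H2 μ) (z : 𝔻) : cauchyU μ h z = cauchyFun μ (h : Lp ℂ 2 μ) z := rfl

theorem inner_cauchyU (g h : H2 μ) : ⟪cauchyU μ g, cauchyU μ h⟫_ℂ = ⟪(g : Lp ℂ 2 μ), h⟫_ℂ :=
  (cauchyU μ).inner_map_map g h

/-- `V_μ = 𝒞_μ Z^μ 𝒞_μ^*`. -/
def V : HPlus μ →L[ℂ] HPlus μ :=
  (cauchyU μ).toContinuousLinearEquiv.toContinuousLinearMap ∘L Z μ ∘L
    (cauchyU μ).symm.toContinuousLinearEquiv.toContinuousLinearMap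

end HPlus

/-! ### The intersection space -/

/-- `int(μ, λ) = ℋ⁺(μ) ∩ ℋ⁺(λ)`, an intersection of spaces of functions on the disk, regarded as a
(not necessarily closed) linear subspace of `ℋ⁺(μ)`. -/
def intSpace (μ lam : Measure Circle) [IsFiniteMeasure μ] [IsFiniteMeasure lam] :
    Submodule ℂ (HPlus μ) :=
  (LinearMap.range (HPlus.toFunₗ lam)).comap (HPlus.toFunₗ μ)

theorem mem_intSpace {μ lam : Measure Circle} [IsFiniteMeasure μ] [IsFiniteMeasure lam]
    {h : HPlus μ} : h ∈ intSpace μ lam ↔ ∃ k : HPlus lam, (k : 𝔻 → ℂ) = h := Iff.rfl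

/-- A linear subspace, closed or not, reduces `T` if it is invariant for `T` and for `T^*`. -/
def IsReducing {H : Type*} [NormedAddCommGroup H] [InnerProductSpace ℂ H] [CompleteSpace H]
    (T : H →L[ℂ] H) (M : Submodule ℂ H) : Prop :=
  ∀ h ∈ M, T h ∈ M ∧ ContinuousLinearMap.adjoint T h ∈ M

/-- `μ ≪_RK λ`: `int(μ, λ)` is norm-dense in `ℋ⁺(μ)`. -/
def RKAbsolutelyContinuous (μ lam : Measure Circle) [IsFiniteMeasure μ] [IsFiniteMeasure lam] :
    Prop :=
  Dense (intSpace μ lam : Set (HPlus μ))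

/-- `μ ⟂_RK λ`: `int(μ, λ) = {0}`. -/
def RKSingular (μ lam : Measure Circle) [IsFiniteMeasure μ] [IsFiniteMeasure lam] : Prop :=
  intSpace μ lam = ⊥

/-- The isometry `e` is the inclusion map: it sends a function in `ℋ⁺(ν)` to the same function,
regarded as an element of `ℋ⁺(μ)`. -/
def IsInclusion {μ ν : Measure Circle} [IsFiniteMeasure μ] [IsFiniteMeasure ν]
    (e : HPlus ν →ₗᵢ[ℂ] HPlus μ) : Prop :=
  ∀ h : HPlus ν, (e h : 𝔻 → ℂ) = h

/-! ### Extreme measures -/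

/-- The contractive analytic functions in the disk (the closed unit ball of `H^∞`). -/
def contractiveAnalytic : Set (𝔻 → ℂ) :=
  {b | (∃ F : ℂ → ℂ, DifferentiableOn ℂ F (Metric.ball 0 1) ∧ ∀ z : 𝔻, b z = F z) ∧
    ∀ z, ‖b z‖ ≤ 1}

/-- The Herglotz–Riesz transform `H_μ(z) = ∫ (1 + z ζ̄) / (1 - z ζ̄) μ(dζ)`. -/
def herglotz (μ : Measure Circle) (z : 𝔻) : ℂ :=
  ∫ ζ : Circle, (1 + (z : ℂ) * conj (ζ : ℂ)) / (1 - (z : ℂ) * conj (ζ : ℂ)) ∂μ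

/-- The contractive analytic function `b_μ = (H_μ - 1) / (H_μ + 1)` whose Clark measure is `μ`. -/
def clark (μ : Measure Circle) (z : 𝔻) : ℂ := (herglotz μ z - 1) / (herglotz μ z + 1)

/-- `μ` is extreme if `b_μ` is an extreme point of the convex set of contractive analytic functions
in the disk. -/
def IsExtremeMeasure (μ : Measure Circle) : Prop :=
  clark μ ∈ Set.extremePoints ℝ contractiveAnalytic

end CauchyTransform

end

open CauchyTransform

/-!
By its Taylor coefficients, the Cauchy transform of `h ∈ L²(μ)` records exactly the Fourier
coefficients of the complex measure `h μ` with nonnegative index, so `int(μ, λ)` consists of the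
pairs `g ∈ H²(μ)`, `k ∈ L²(λ)` for which `g μ` and `k λ` agree in all these coefficients.
Multiplication by `ζ` and `ζ̄` shifts the coefficients.

In (a), `V_μ^*` drops the zeroth coefficient and thus always preserves `int(μ, λ)`, while `V_μ`
preserves it up to the coefficient of index `-1`, that is up to a constant. If `λ` is non-extreme,
then `b_λ` is a proper convex combination of contractive functions, whence `|b_λ|² + |F|² ≤ 1` and
`|G|² ≤ Re H_λ` with nonzero analytic `F` and `G`. Integrating `|q G|²` over circles, for a
polynomial `q`, and dividing `G` by a power of `z` in case `G(0) = 0`, one finds that `q ↦ q(0)` is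
bounded in the norm of `L²(λ)`, and this says that the constants belong to `ℋ⁺(λ)`.

In (b), if the constants do not belong to `ℋ⁺(λ)`, then `V_μ`-invariance forces `g μ = k λ`. If they
do, then Lebesgue measure is absolutely continuous with respect to `λ`, and the F. and M. Riesz
theorem applies to `g μ - k λ`. In both cases `g` vanishes on each `λ`-null set. As
`int(μ_ac, λ)` is dense in `ℋ⁺(μ_ac)`, it follows that multiplication by the indicator function of
a set carrying `μ_ac` preserves `H²(μ)`, and `H²(μ)` splits.
-/

noncomputable section

namespace CauchyTransform

section Lp

variable {α E : Type*} {m : MeasurableSpace α} {μ ν : Measure α} [NormedAddCommGroup E]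
  {p c : ℝ≥0∞} [Fact (1 ≤ p)] {s : Set α}

section NormedSpace

variable (𝕜 : Type*) [NormedField 𝕜] [NormedSpace 𝕜 E]

/-- The identity map `L^p(μ) → L^p(ν)`, which is bounded if `ν ≤ c μ` with a finite constant `c`. -/
def changeMeasure (hc : c ≠ ∞) (h : ν ≤ c • μ) : Lp E p μ →L[𝕜] Lp E p ν :=
  LinearMap.mkContinuous
    { toFun := fun f => ((Lp.memLp f).of_measure_le_smul hc h).toLp f
      map_add' := fun f g => by
        rw [← MemLp.toLp_add]
        exact MemLp.toLp_congr _ _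
          ((Measure.absolutelyContinuous_of_le_smul h).ae_eq (Lp.coeFn_add f g))
      map_smul' := fun a f => by
        rw [RingHom.id_apply, ← MemLp.toLp_const_smul]
        exact MemLp.toLp_congr _ _
          ((Measure.absolutelyContinuous_of_le_smul h).ae_eq (Lp.coeFn_smul a f)) }
    (c ^ (1 / p).toReal).toReal fun f => by
      simp only [LinearMap.coe_mk, AddHom.coe_mk, Lp.norm_toLp]
      rw [Lp.norm_def, ← ENNReal.toReal_mul]
      have hcp : c ^ (1 / p).toReal ≠ ∞ := ENNReal.rpow_ne_top_of_nonneg ENNReal.toReal_nonneg hc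
      exact ENNReal.toReal_mono (ENNReal.mul_ne_top hcp (Lp.eLpNorm_ne_top f))
        (eLpNorm_le_of_measure_le_smul h)

theorem coeFn_changeMeasure (hc : c ≠ ∞) (h : ν ≤ c • μ) (f : Lp E p μ) :
    changeMeasure 𝕜 hc h f =ᵐ[ν] f :=
  ((Lp.memLp f).of_measure_le_smul hc h).coeFn_toLp

/-- Extension by zero, as an isometric embedding of `L^p(μ|s)` into `L^p(μ)`. -/
def extendLp (hs : MeasurableSet s) : Lp E p (μ.restrict s) →ₗᵢ[𝕜] Lp E p μ where
  toFun f := ((memLp_indicator_iff_restrict hs).2 (Lp.memLp f)).toLp _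
  map_add' f g := by
    rw [← MemLp.toLp_add]
    refine MemLp.toLp_congr _ _ ?_
    rw [← Set.indicator_add']
    exact (ae_eq_restrict_iff_indicator_ae_eq hs).1 (Lp.coeFn_add f g)
  map_smul' a f := by
    rw [RingHom.id_apply, ← MemLp.toLp_const_smul]
    refine MemLp.toLp_congr _ _ (((ae_eq_restrict_iff_indicator_ae_eq hs).1
      (Lp.coeFn_smul a f)).trans ?_)
    rw [Pi.smul_def, Set.indicator_const_smul]
    rfl
  norm_map' f := by
    simp only [LinearMap.coe_mk, AddHom.coe_mk, Lp.norm_toLp]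
    rw [Lp.norm_def, eLpNorm_indicator_eq_eLpNorm_restrict hs]

theorem coeFn_extendLp (hs : MeasurableSet s) (f : Lp E p (μ.restrict s)) :
    extendLp 𝕜 hs f =ᵐ[μ] s.indicator f :=
  ((memLp_indicator_iff_restrict hs).2 (Lp.memLp f)).coeFn_toLp

/-- Multiplication by the indicator function of `s` on `L^p(μ)`. -/
def indicatorLp (hs : MeasurableSet s) : Lp E p μ →L[𝕜] Lp E p μ :=
  (extendLp 𝕜 hs).toContinuousLinearMap ∘L LpToLpRestrictCLM α E 𝕜 μ p s

theorem coeFn_indicatorLp (hs : MeasurableSet s) (f : Lp E p μ) :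
    indicatorLp 𝕜 hs f =ᵐ[μ] s.indicator f :=
  (coeFn_extendLp 𝕜 hs _).trans
    ((ae_eq_restrict_iff_indicator_ae_eq hs).1 (LpToLpRestrictCLM_coeFn 𝕜 s f))

theorem indicatorLp_add_indicatorLp_compl (hs : MeasurableSet s) (f : Lp E p μ) :
    indicatorLp 𝕜 hs f + indicatorLp 𝕜 hs.compl f = f := by
  refine Lp.ext ((Lp.coeFn_add _ _).trans ?_)
  filter_upwards [coeFn_indicatorLp 𝕜 hs f, coeFn_indicatorLp 𝕜 hs.compl f] with x h1 h2
  rw [Pi.add_apply, h1, h2, Set.indicator_self_add_compl_apply]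

theorem indicatorLp_eq_zero_iff (hs : MeasurableSet s) {f : Lp E p μ} :
    indicatorLp 𝕜 hs f = 0 ↔ ∀ᵐ x ∂μ, x ∈ s → f x = 0 := by
  rw [Lp.eq_zero_iff_ae_eq_zero]
  refine ⟨fun h => ?_, fun h => ?_⟩
  · filter_upwards [h, coeFn_indicatorLp 𝕜 hs f] with x h1 h2 hx
    rwa [h2, Set.indicator_of_mem hx] at h1
  · filter_upwards [h, coeFn_indicatorLp 𝕜 hs f] with x h1 h2
    rw [h2, Pi.zero_apply, Set.indicator_apply_eq_zero]
    exact h1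

theorem indicatorLp_eq_zero_of_measure_zero (hs : MeasurableSet s) (h : μ s = 0) (f : Lp E p μ) :
    indicatorLp 𝕜 hs f = 0 :=
  (indicatorLp_eq_zero_iff 𝕜 hs).2 <| by
    filter_upwards [measure_eq_zero_iff_ae_notMem.1 h] with x hx hxs using absurd hxs hx

theorem indicatorLp_compl_extendLp (hs : MeasurableSet s) (f : Lp E p (μ.restrict s)) :
    indicatorLp 𝕜 hs.compl (extendLp 𝕜 hs f) = 0 := by
  rw [indicatorLp_eq_zero_iff]
  filter_upwards [coeFn_extendLp 𝕜 hs f] with x h1 hx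
  rw [h1, Set.indicator_of_notMem hx]

theorem indicatorLp_changeMeasure (hc : c ≠ ∞) (h : ν ≤ c • μ) (hs : MeasurableSet s)
    (f : Lp E p μ) :
    indicatorLp 𝕜 hs (changeMeasure 𝕜 hc h f) = changeMeasure 𝕜 hc h (indicatorLp 𝕜 hs f) := by
  refine Lp.ext ?_
  filter_upwards [coeFn_indicatorLp 𝕜 hs (changeMeasure 𝕜 hc h f), coeFn_changeMeasure 𝕜 hc h f,
    coeFn_changeMeasure 𝕜 hc h (indicatorLp 𝕜 hs f),
    (Measure.absolutelyContinuous_of_le_smul h).ae_eq (coeFn_indicatorLp 𝕜 hs f)] with x h1 h2 h3 h4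
  by_cases hx : x ∈ s
  · rw [h1, h3, h4, Set.indicator_of_mem hx, Set.indicator_of_mem hx, h2]
  · rw [h1, h3, h4, Set.indicator_of_notMem hx, Set.indicator_of_notMem hx]

end NormedSpace

section InnerProductSpace

variable {𝕜 : Type*} [RCLike 𝕜] [InnerProductSpace 𝕜 E]

theorem inner_extendLp_right (hs : MeasurableSet s) (f : Lp E 2 μ) (g : Lp E 2 (μ.restrict s)) :
    ⟪f, extendLp 𝕜 hs g⟫_𝕜 = ⟪LpToLpRestrictCLM α E 𝕜 μ 2 s f, g⟫_𝕜 := by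
  rw [L2.inner_def, L2.inner_def, ← integral_indicator hs]
  refine integral_congr_ae ?_
  filter_upwards [coeFn_extendLp 𝕜 hs g,
    (ae_restrict_iff' hs).1 (LpToLpRestrictCLM_coeFn 𝕜 s f)] with x h1 h2
  by_cases hx : x ∈ s
  · simp [h1, h2 hx, hx]
  · simp [h1, hx]

theorem inner_indicatorLp_right (hs : MeasurableSet s) (f g : Lp E 2 μ) :
    ⟪f, indicatorLp 𝕜 hs g⟫_𝕜 = ⟪indicatorLp 𝕜 hs f, indicatorLp 𝕜 hs g⟫_𝕜 :=
  (inner_extendLp_right hs f _).trans ((extendLp 𝕜 hs).inner_map_map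
    (LpToLpRestrictCLM α E 𝕜 μ 2 s f) (LpToLpRestrictCLM α E 𝕜 μ 2 s g)).symm

theorem inner_indicatorLp_left (hs : MeasurableSet s) (f g : Lp E 2 μ) :
    ⟪indicatorLp 𝕜 hs f, g⟫_𝕜 = ⟪f, indicatorLp 𝕜 hs g⟫_𝕜 := by
  rw [inner_indicatorLp_right, ← inner_conj_symm, inner_indicatorLp_right, inner_conj_symm]

theorem inner_extendLp_extendLp_compl (hs : MeasurableSet s) (f : Lp E 2 (μ.restrict s))
    (g : Lp E 2 (μ.restrict sᶜ)) : ⟪extendLp 𝕜 hs f, extendLp 𝕜 hs.compl g⟫_𝕜 = 0 := by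
  have hf : LpToLpRestrictCLM α E 𝕜 μ 2 sᶜ (extendLp 𝕜 hs f) = 0 :=
    (map_eq_zero_iff _ (extendLp 𝕜 hs.compl).injective).1 (indicatorLp_compl_extendLp 𝕜 hs f)
  rw [inner_extendLp_right, hf, inner_zero_left]

end InnerProductSpace

end Lp

theorem exists_restrict_le_natCast_smul {α : Type*} {m : MeasurableSpace α} {μ ν : Measure α}
    [SigmaFinite ν] [ν.HaveLebesgueDecomposition μ] (h : ν ≪ μ) :
    ∃ A : ℕ → Set α, (∀ n, MeasurableSet (A n)) ∧ (∀ n, ν.restrict (A n) ≤ (n : ℝ≥0∞) • μ) ∧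
      ∀ᵐ x ∂ν, ∃ n, x ∈ A n := by
  have hA (n : ℕ) : MeasurableSet {x | ν.rnDeriv μ x ≤ n} :=
    measurableSet_le (ν.measurable_rnDeriv μ) measurable_const
  refine ⟨fun n => {x | ν.rnDeriv μ x ≤ n}, hA, fun n => ?_, ?_⟩
  · calc ν.restrict {x | ν.rnDeriv μ x ≤ n}
        = (μ.withDensity (ν.rnDeriv μ)).restrict {x | ν.rnDeriv μ x ≤ n} := by
          rw [Measure.withDensity_rnDeriv_eq ν μ h]
      _ = μ.withDensity ({x | ν.rnDeriv μ x ≤ n}.indicator (ν.rnDeriv μ)) := by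
          rw [restrict_withDensity (hA n), withDensity_indicator (hA n)]
      _ ≤ μ.withDensity fun _ => n :=
          withDensity_mono (ae_of_all _ (Set.indicator_le fun _ hx => hx))
      _ = (n : ℝ≥0∞) • μ := withDensity_const _
  · filter_upwards [h.ae_le (ν.rnDeriv_lt_top μ)] with x hx
    obtain ⟨n, hn⟩ := ENNReal.exists_nat_gt hx.ne
    exact ⟨n, hn.le⟩

theorem exists_eq_restrict_of_mutuallySingular {α : Type*} {m : MeasurableSpace α}
    {μ ν ρ σ : Measure α} (h : μ = ρ + σ) (hρ : ρ ≪ ν) (hσ : σ ⟂ₘ ν) :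
    ∃ s, MeasurableSet s ∧ ν sᶜ = 0 ∧ ρ = μ.restrict s ∧ σ = μ.restrict sᶜ := by
  obtain ⟨s, hs, hσs, hνs⟩ := hσ
  refine ⟨s, hs, hνs, ?_, ?_⟩
  · have hρs : ∀ᵐ x ∂ρ, x ∈ s := hρ hνs
    rw [h, Measure.restrict_add, Measure.restrict_eq_zero.2 hσs, add_zero,
      Measure.restrict_eq_self_of_ae_mem hρs]
  · have hσs' : ∀ᵐ x ∂σ, x ∈ sᶜ := compl_mem_ae_iff.2 hσs
    rw [h, Measure.restrict_add, Measure.restrict_eq_zero.2 (hρ hνs), zero_add,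
      Measure.restrict_eq_self_of_ae_mem hσs']

/-- The character `ζ ↦ ζ ^ n` of the circle. -/
def zetaPow (n : ℤ) : C(Circle, ℂ) :=
  ⟨fun ζ => ((ζ ^ n : Circle) : ℂ), continuous_circle_coe.comp (continuous_zpow n)⟩

theorem zetaPow_apply (n : ℤ) (ζ : Circle) : zetaPow n ζ = ((ζ ^ n : Circle) : ℂ) := rfl

theorem zetaPow_zero : zetaPow 0 = 1 := by
  ext ζ
  simp [zetaPow_apply]

theorem zetaPow_one : zetaPow 1 = zeta := by
  ext ζ
  simp [zetaPow_apply, zeta_apply]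

theorem zetaPow_add (m n : ℤ) : zetaPow (m + n) = zetaPow m * zetaPow n := by
  ext ζ
  simp [zetaPow_apply, zpow_add]

theorem zetaPow_natCast (n : ℕ) : zetaPow n = zeta ^ n := by
  ext ζ
  simp [zetaPow_apply, zeta_apply]

theorem star_zetaPow (n : ℤ) : star (zetaPow n) = zetaPow (-n) := by
  ext ζ
  simp only [ContinuousMap.star_apply, zetaPow_apply, zpow_neg, Circle.coe_inv_eq_conj]
  rfl

theorem conj_zetaPow (n : ℤ) (ζ : Circle) : conj (zetaPow n ζ) = zetaPow (-n) ζ :=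
  DFunLike.congr_fun (star_zetaPow n) ζ

theorem dense_span_range_zetaPow :
    Dense (Submodule.span ℂ (Set.range zetaPow) : Set C(Circle, ℂ)) := by
  have hsep : (StarAlgebra.adjoin ℂ {zeta}).topologicalClosure = ⊤ :=
    ContinuousMap.starSubalgebra_topologicalClosure_eq_top_of_separatesPoints _ fun x y hxy =>
      ⟨_, ⟨zeta, StarAlgebra.self_mem_adjoin_singleton ℂ zeta, rfl⟩, fun e => hxy (Circle.ext e)⟩
  have hdense : Dense (StarAlgebra.adjoin ℂ {zeta} : Set C(Circle, ℂ)) :=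
    dense_iff_closure_eq.2 (congrArg SetLike.coe hsep)
  refine hdense.mono fun f hf => ?_
  rw [SetLike.mem_coe, ← StarSubalgebra.mem_toSubalgebra, ← Subalgebra.mem_toSubmodule,
    StarAlgebra.adjoin_eq_span] at hf
  refine Submodule.span_mono (fun g hg => ?_) hf
  induction hg using Submonoid.closure_induction with
  | one => exact ⟨0, zetaPow_zero⟩
  | mul _ _ _ _ hx hy =>
    obtain ⟨⟨m, rfl⟩, n, rfl⟩ := hx, hy
    exact ⟨m + n, zetaPow_add m n⟩
  | mem x hx =>
    rcases hx with hx | hx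
    · exact ⟨1, zetaPow_one.trans hx.symm⟩
    · refine ⟨-1, ?_⟩
      rw [← star_zetaPow, zetaPow_one, ← star_star x, Set.mem_singleton_iff.1 hx]

section FourierCoeff

variable {μ ν : Measure Circle} [IsFiniteMeasure μ] [IsFiniteMeasure ν]

/-- The character `ζ ↦ ζ ^ n` as an element of `L²(μ)`. -/
def zetaPowLp (μ : Measure Circle) [IsFiniteMeasure μ] (n : ℤ) : Lp ℂ 2 μ :=
  ContinuousMap.toLp 2 μ ℂ (zetaPow n)

theorem coeFn_zetaPowLp (n : ℤ) : zetaPowLp μ n =ᵐ[μ] zetaPow n :=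
  ContinuousMap.coeFn_toLp (𝕜 := ℂ) μ _

theorem polyLp_X_pow (n : ℕ) : polyLp μ (X ^ n) = zetaPowLp μ n := by
  simp [polyLp, zetaPowLp, zetaPow_natCast]

/-- The Fourier coefficient `∫ ζ⁻ⁿ h(ζ) μ(dζ)` of the complex measure `h μ`. -/
def fourierCoeffLp (n : ℤ) : Lp ℂ 2 μ →L[ℂ] ℂ := innerSL ℂ (zetaPowLp μ n)

theorem fourierCoeffLp_apply (n : ℤ) (h : Lp ℂ 2 μ) : fourierCoeffLp n h = ⟪zetaPowLp μ n, h⟫_ℂ :=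
  rfl

theorem fourierCoeffLp_zetaPowLp_zero (n : ℤ) :
    fourierCoeffLp n (zetaPowLp μ 0) = ∫ ζ, zetaPow (-n) ζ ∂μ := by
  rw [fourierCoeffLp_apply, L2.inner_def]
  refine integral_congr_ae ?_
  filter_upwards [coeFn_zetaPowLp (μ := μ) n, coeFn_zetaPowLp (μ := μ) 0] with ζ h1 h2
  simp [h1, h2, zetaPow_zero, conj_zetaPow]

theorem eq_zero_of_fourierCoeffLp {h : Lp ℂ 2 μ} (hh : ∀ n, fourierCoeffLp n h = 0) : h = 0 := by
  have hperp : innerSL ℂ h ∘L ContinuousMap.toLp 2 μ ℂ = 0 := by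
    refine ContinuousLinearMap.ext_on dense_span_range_zetaPow ?_
    rintro _ ⟨n, rfl⟩
    exact inner_eq_zero_symm.1 ((fourierCoeffLp_apply n h).symm.trans (hh n))
  have hd : DenseRange (ContinuousMap.toLp 2 μ ℂ : C(Circle, ℂ) → Lp ℂ 2 μ) :=
    ContinuousMap.toLp_denseRange ℂ μ ℂ (by norm_num)
  exact hd.eq_zero_of_inner_right ℂ fun f => inner_eq_zero_symm.1 (DFunLike.congr_fun hperp f)

theorem changeMeasure_zetaPowLp {c : ℝ≥0∞} (hc : c ≠ ∞) (h : ν ≤ c • μ) (n : ℤ) :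
    changeMeasure ℂ hc h (zetaPowLp μ n) = zetaPowLp ν n :=
  Lp.ext <| ((coeFn_changeMeasure ℂ hc h _).trans
    ((Measure.absolutelyContinuous_of_le_smul h).ae_eq (coeFn_zetaPowLp n))).trans
      (coeFn_zetaPowLp n).symm

theorem fourierCoeffLp_adjoint_changeMeasure {c : ℝ≥0∞} (hc : c ≠ ∞) (h : ν ≤ c • μ) (n : ℤ)
    (f : Lp ℂ 2 ν) : fourierCoeffLp n ((changeMeasure ℂ hc h).adjoint f) = fourierCoeffLp n f := by
  rw [fourierCoeffLp_apply, ContinuousLinearMap.adjoint_inner_right, changeMeasure_zetaPowLp,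
    fourierCoeffLp_apply]

theorem fourierCoeffLp_extendLp {s : Set Circle} (hs : MeasurableSet s) (n : ℤ)
    (f : Lp ℂ 2 (μ.restrict s)) :
    fourierCoeffLp n (extendLp ℂ hs f) = fourierCoeffLp n f := by
  have hn : LpToLpRestrictCLM Circle ℂ ℂ μ 2 s (zetaPowLp μ n) = zetaPowLp (μ.restrict s) n :=
    Lp.ext <| ((LpToLpRestrictCLM_coeFn ℂ s _).trans (ae_restrict_of_ae (coeFn_zetaPowLp n))).trans
      (coeFn_zetaPowLp n).symm
  rw [fourierCoeffLp_apply, inner_extendLp_right, hn, fourierCoeffLp_apply]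

theorem inner_indicatorLp_zetaPowLp_zero {s : Set Circle} (hs : MeasurableSet s) :
    ⟪indicatorLp ℂ hs (zetaPowLp μ 0), zetaPowLp μ 0⟫_ℂ = μ.real s := by
  rw [L2.inner_def, ← mul_one ((μ.real s : ℂ)), ← Complex.real_smul, ← setIntegral_const,
    ← integral_indicator hs]
  refine integral_congr_ae ?_
  filter_upwards [coeFn_indicatorLp ℂ hs (zetaPowLp μ 0), coeFn_zetaPowLp (μ := μ) 0] with ζ h1 h2
  by_cases hζ : ζ ∈ s <;> simp [h1, h2, hζ, zetaPow_zero]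

theorem measure_ext_of_integral_zetaPow
    (h : ∀ n : ℤ, ∫ ζ, zetaPow n ζ ∂μ = ∫ ζ, zetaPow n ζ ∂ν) : μ = ν := by
  have hμ : μ ≤ (1 : ℝ≥0∞) • (μ + ν) := by rw [one_smul]; exact Measure.le_add_right le_rfl
  have hν : ν ≤ (1 : ℝ≥0∞) • (μ + ν) := by rw [one_smul]; exact Measure.le_add_left le_rfl
  have hdens : (changeMeasure ℂ ENNReal.one_ne_top hμ).adjoint (zetaPowLp μ 0) =
      (changeMeasure ℂ ENNReal.one_ne_top hν).adjoint (zetaPowLp ν 0) := by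
    refine sub_eq_zero.1 (eq_zero_of_fourierCoeffLp fun n => ?_)
    rw [map_sub, fourierCoeffLp_adjoint_changeMeasure, fourierCoeffLp_adjoint_changeMeasure,
      fourierCoeffLp_zetaPowLp_zero, fourierCoeffLp_zetaPowLp_zero, h, sub_self]
  ext s hs
  have hs' := congrArg (⟪indicatorLp ℂ hs (zetaPowLp (μ + ν) 0), ·⟫_ℂ) hdens
  simp only [ContinuousLinearMap.adjoint_inner_right, ← indicatorLp_changeMeasure,
    changeMeasure_zetaPowLp, inner_indicatorLp_zetaPowLp_zero] at hs'
  exact (measureReal_eq_measureReal_iff).1 (Complex.ofReal_injective hs')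

end FourierCoeff

section Shift

variable {μ : Measure Circle}

theorem coeFn_mulZeta (h : Lp ℂ 2 μ) : mulZeta μ h =ᵐ[μ] fun ζ => (ζ : ℂ) * h ζ :=
  MemLp.coeFn_toLp (memLp_zeta_mul h)

variable [IsFiniteMeasure μ]

theorem mulZeta_zetaPowLp (n : ℤ) : mulZeta μ (zetaPowLp μ n) = zetaPowLp μ (n + 1) := by
  refine Lp.ext ?_
  filter_upwards [coeFn_mulZeta (zetaPowLp μ n), coeFn_zetaPowLp (μ := μ) n,
    coeFn_zetaPowLp (μ := μ) (n + 1)] with ζ h1 h2 h3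
  rw [h1, h2, h3, add_comm, zetaPow_add, zetaPow_one, ContinuousMap.mul_apply, zeta_apply]

theorem mulZeta_surjective (μ : Measure Circle) [IsFiniteMeasure μ] :
    Function.Surjective (mulZeta μ) := by
  have hclosed : IsClosed ((mulZeta μ).range : Set (Lp ℂ 2 μ)) :=
    (mulZeta μ).isometry.isClosedEmbedding.isClosed_range
  have : CompleteSpace (mulZeta μ).range := hclosed.completeSpace_coe
  refine LinearMap.range_eq_top.1 ((Submodule.orthogonal_eq_bot_iff).1 ?_)
  refine (Submodule.eq_bot_iff _).2 fun y hy => eq_zero_of_fourierCoeffLp fun n => ?_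
  rw [fourierCoeffLp_apply, ← sub_add_cancel n 1, ← mulZeta_zetaPowLp]
  exact hy _ ⟨_, rfl⟩

/-- Multiplication by `ζ` as a unitary operator on `L²(μ)`. -/
def mulZetaEquiv (μ : Measure Circle) [IsFiniteMeasure μ] : Lp ℂ 2 μ ≃ₗᵢ[ℂ] Lp ℂ 2 μ :=
  LinearIsometryEquiv.ofSurjective (mulZeta μ) (mulZeta_surjective μ)

theorem coeFn_mulZetaEquiv_zpow (n : ℤ) (h : Lp ℂ 2 μ) :
    (mulZetaEquiv μ ^ n) h =ᵐ[μ] fun ζ => zetaPow n ζ * h ζ := by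
  have hsucc (n : ℤ) : (mulZetaEquiv μ ^ (n + 1)) h =ᵐ[μ]
      fun ζ => (ζ : ℂ) * (mulZetaEquiv μ ^ n) h ζ := by
    rw [add_comm, zpow_add, zpow_one]
    exact coeFn_mulZeta _
  induction n using Int.induction_on with
  | zero => simp [zetaPow_zero]
  | succ n ih =>
    filter_upwards [hsucc n, ih] with ζ h1 h2
    rw [h1, h2, ← mul_assoc, add_comm (n : ℤ), zetaPow_add, zetaPow_one, ContinuousMap.mul_apply,
      zeta_apply]
  | pred n ih =>
    filter_upwards [hsucc (-n - 1), ih] with ζ h1 h2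
    refine mul_left_cancel₀ (Circle.coe_ne_zero ζ) ?_
    rw [sub_add_cancel, h2] at h1
    rw [← h1, ← mul_assoc, ← zeta_apply, ← zetaPow_one, ← ContinuousMap.mul_apply, ← zetaPow_add,
      add_sub_cancel]

theorem mulZetaEquiv_zpow_zetaPowLp (m n : ℤ) :
    (mulZetaEquiv μ ^ m) (zetaPowLp μ n) = zetaPowLp μ (m + n) := by
  refine Lp.ext ?_
  filter_upwards [coeFn_mulZetaEquiv_zpow m (zetaPowLp μ n), coeFn_zetaPowLp (μ := μ) n,
    coeFn_zetaPowLp (μ := μ) (m + n)] with ζ h1 h2 h3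
  rw [h1, h2, h3, zetaPow_add, ContinuousMap.mul_apply]

theorem fourierCoeffLp_mulZetaEquiv_zpow (m n : ℤ) (h : Lp ℂ 2 μ) :
    fourierCoeffLp n ((mulZetaEquiv μ ^ m) h) = fourierCoeffLp (n - m) h := by
  rw [fourierCoeffLp_apply, fourierCoeffLp_apply,
    ← (mulZetaEquiv μ ^ m).inner_map_map (zetaPowLp μ (n - m)), mulZetaEquiv_zpow_zetaPowLp,
    add_sub_cancel]

theorem fourierCoeffLp_mulZeta (n : ℤ) (h : Lp ℂ 2 μ) :
    fourierCoeffLp n (mulZeta μ h) = fourierCoeffLp (n - 1) h :=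
  fourierCoeffLp_mulZetaEquiv_zpow 1 n h

end Shift

section CauchyTransform

variable {μ lam : Measure Circle} [IsFiniteMeasure μ] [IsFiniteMeasure lam]

theorem zetaPowLp_natCast_mem_H2 (n : ℕ) : zetaPowLp μ n ∈ H2 μ :=
  subset_closure ⟨X ^ n, polyLp_X_pow n⟩

theorem mem_orthogonal_H2 {h : Lp ℂ 2 μ} :
    h ∈ (H2 μ)ᗮ ↔ ∀ n : ℕ, fourierCoeffLp n h = 0 := by
  refine ⟨fun hh n => hh _ (zetaPowLp_natCast_mem_H2 n), fun hh => ?_⟩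
  rw [H2, Submodule.orthogonal_closure, Submodule.mem_orthogonal]
  rintro _ ⟨p, rfl⟩
  induction p using Polynomial.induction_on' with
  | add p q hp hq => rw [map_add, inner_add_left, hp, hq, add_zero]
  | monomial n a =>
    rw [← Polynomial.smul_X_eq_monomial, map_smul, inner_smul_left, polyLp_X_pow,
      ← fourierCoeffLp_apply, hh, mul_zero]

theorem fourierCoeffLp_orthogonalProjectionOnto_H2 (h : Lp ℂ 2 μ) (n : ℕ) :
    fourierCoeffLp n ((H2 μ).orthogonalProjectionOnto h : Lp ℂ 2 μ) = fourierCoeffLp n h := by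
  have := mem_orthogonal_H2.1 ((H2 μ).sub_starProjection_mem_orthogonal h) n
  rw [map_sub, sub_eq_zero] at this
  exact this.symm

theorem hasSum_cauchyFun (h : Lp ℂ 2 μ) (z : 𝔻) :
    HasSum (fun n : ℕ => (z : ℂ) ^ n * fourierCoeffLp n h) (cauchyFun μ h z) := by
  have hsum := (((hasSum_szego z).mapL (ContinuousMap.toLp 2 μ ℂ)).mapL (innerSL ℂ h)).star
  rw [cauchyFun_eq_inner, ← inner_conj_symm]
  refine hsum.congr_fun fun n => ?_
  rw [fourierCoeffLp_apply, ← inner_conj_symm, zetaPowLp, zetaPow_natCast]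
  simp

theorem cauchyFun_eq_cauchyFun_iff {h : Lp ℂ 2 μ} {k : Lp ℂ 2 lam} :
    cauchyFun μ h = cauchyFun lam k ↔ ∀ n : ℕ, fourierCoeffLp n h = fourierCoeffLp n k := by
  refine ⟨fun e n => ?_, fun e => ?_⟩
  · have hp : HasFPowerSeriesAt (0 : ℂ → ℂ) (FormalMultilinearSeries.ofScalars ℂ
        fun n : ℕ => fourierCoeffLp n h - fourierCoeffLp n k) 0 := by
      rw [hasFPowerSeriesAt_iff]
      filter_upwards [Metric.ball_mem_nhds (0 : ℂ) one_pos] with z hz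
      have hsum := (hasSum_cauchyFun h ⟨z, hz⟩).sub (hasSum_cauchyFun k ⟨z, hz⟩)
      simp only [FormalMultilinearSeries.coeff_ofScalars, smul_eq_mul, Pi.zero_apply, mul_sub]
      rwa [e, sub_self] at hsum
    have hn := congrArg (fun p => FormalMultilinearSeries.coeff p n) hp.eq_zero
    simp only [FormalMultilinearSeries.coeff_ofScalars] at hn
    exact sub_eq_zero.1 hn
  · ext z
    have hz := hasSum_cauchyFun h z
    simp only [e] at hz
    exact hz.unique (hasSum_cauchyFun k z)

theorem mem_range_toFunₗ {F : 𝔻 → ℂ} :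
    F ∈ LinearMap.range (HPlus.toFunₗ μ) ↔ ∃ h : Lp ℂ 2 μ, cauchyFun μ h = F := by
  constructor
  · rintro ⟨f, rfl⟩
    obtain ⟨g, rfl⟩ := (cauchyU μ).surjective f
    exact ⟨g, rfl⟩
  · rintro ⟨h, rfl⟩
    exact ⟨cauchyU μ ((H2 μ).orthogonalProjectionOnto h),
      cauchyFun_eq_cauchyFun_iff.2 (fourierCoeffLp_orthogonalProjectionOnto_H2 h)⟩

theorem cauchyU_mem_intSpace {g : H2 μ} : cauchyU μ g ∈ intSpace μ lam ↔
    ∃ k : Lp ℂ 2 lam, ∀ n : ℕ, fourierCoeffLp n (g : Lp ℂ 2 μ) = fourierCoeffLp n k :=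
  mem_range_toFunₗ.trans
    (exists_congr fun _ => eq_comm.trans (cauchyFun_eq_cauchyFun_iff (h := (g : Lp ℂ 2 μ))))

theorem cauchyU_orthogonalProjectionOnto_mem_intSpace {h : Lp ℂ 2 μ} {k : Lp ℂ 2 lam}
    (e : ∀ n : ℕ, fourierCoeffLp n h = fourierCoeffLp n k) :
    cauchyU μ ((H2 μ).orthogonalProjectionOnto h) ∈ intSpace μ lam :=
  cauchyU_mem_intSpace.2
    ⟨k, fun n => (fourierCoeffLp_orthogonalProjectionOnto_H2 h n).trans (e n)⟩

end CauchyTransform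

section Haar

/-- Normalized Lebesgue measure on the unit circle. -/
def circleHaar : Measure Circle := Measure.haarMeasure ⊤

instance : circleHaar.IsMulLeftInvariant :=
  inferInstanceAs (Measure.haarMeasure _).IsMulLeftInvariant

instance : IsProbabilityMeasure circleHaar := ⟨Measure.haarMeasure_self⟩

theorem integral_zetaPow_circleHaar {n : ℤ} (hn : n ≠ 0) : ∫ ζ, zetaPow n ζ ∂circleHaar = 0 := by
  let a : Circle := Circle.exp (Real.pi / n)
  have ha : zetaPow n a = -1 := by
    rw [zetaPow_apply, ← Circle.exp_intCast_mul, mul_div_cancel₀ _ (Int.cast_ne_zero.2 hn),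
      Circle.coe_exp, Complex.exp_pi_mul_I]
  have hinv := integral_mul_left_eq_self (μ := circleHaar) (fun ζ => zetaPow n ζ) a
  have hmul (ζ : Circle) : zetaPow n (a * ζ) = -zetaPow n ζ := by
    rw [zetaPow_apply, mul_zpow, Circle.coe_mul, ← zetaPow_apply, ha, neg_one_mul, zetaPow_apply]
  simp only [hmul, integral_neg] at hinv
  exact self_eq_neg.1 hinv.symm

end Haar

section Reducing

variable {μ lam : Measure Circle} [IsFiniteMeasure μ] [IsFiniteMeasure lam]

/-- The constant functions belong to `ℋ⁺(λ)`. -/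
def ContainsConst (lam : Measure Circle) [IsFiniteMeasure lam] : Prop :=
  (1 : 𝔻 → ℂ) ∈ LinearMap.range (HPlus.toFunₗ lam)

theorem containsConst_iff : ContainsConst lam ↔ ∃ k : Lp ℂ 2 lam,
    fourierCoeffLp 0 k = 1 ∧ ∀ n : ℕ, fourierCoeffLp (n + 1) k = 0 := by
  have hcoeff (n : ℕ) :
      fourierCoeffLp n (zetaPowLp circleHaar 0) = if n = 0 then 1 else 0 := by
    rw [fourierCoeffLp_zetaPowLp_zero]
    split_ifs with hn
    · simp [hn, zetaPow_zero]
    · exact integral_zetaPow_circleHaar (by simpa using hn)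
  have hone : cauchyFun circleHaar (zetaPowLp circleHaar 0) = 1 := by
    ext z
    have hsum := hasSum_cauchyFun (zetaPowLp circleHaar 0) z
    simp only [hcoeff] at hsum
    simpa using hsum.unique (hasSum_single 0 fun n hn => by simp [hn])
  rw [ContainsConst, mem_range_toFunₗ, ← hone]
  refine exists_congr fun k => ?_
  simp only [cauchyFun_eq_cauchyFun_iff, hcoeff]
  refine ⟨fun h => ⟨by simpa using h 0, fun n => by simpa using h (n + 1)⟩, ?_⟩
  rintro ⟨h0, h1⟩ (_ | n)
  · simpa using h0
  · simpa using h1 n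

theorem V_cauchyU (g : H2 μ) : V μ (cauchyU μ g) = cauchyU μ (Z μ g) :=
  congrArg (fun h => cauchyU μ (Z μ h)) ((cauchyU μ).symm_apply_apply g)

theorem coe_Z (g : H2 μ) : (Z μ g : Lp ℂ 2 μ) = mulZeta μ g := rfl

theorem fourierCoeffLp_adjoint_V (g : H2 μ) (n : ℕ) :
    fourierCoeffLp n
      ((cauchyU μ).symm ((V μ).adjoint (cauchyU μ g)) : Lp ℂ 2 μ) =
        fourierCoeffLp (n + 1) (g : Lp ℂ 2 μ) := by
  let ζn : H2 μ := ⟨zetaPowLp μ n, zetaPowLp_natCast_mem_H2 n⟩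
  calc fourierCoeffLp n ((cauchyU μ).symm ((V μ).adjoint (cauchyU μ g)) : Lp ℂ 2 μ)
      = ⟪cauchyU μ ζn, (V μ).adjoint (cauchyU μ g)⟫_ℂ := by
        rw [← (cauchyU μ).symm.inner_map_map, LinearIsometryEquiv.symm_apply_apply]
        rfl
    _ = ⟪(Z μ ζn : Lp ℂ 2 μ), g⟫_ℂ := by
        rw [ContinuousLinearMap.adjoint_inner_right, V_cauchyU, inner_cauchyU]
    _ = fourierCoeffLp (n + 1) (g : Lp ℂ 2 μ) := by
        rw [coe_Z, mulZeta_zetaPowLp, fourierCoeffLp_apply]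

theorem isReducing_intSpace_of_containsConst (hc : ContainsConst lam) :
    IsReducing (V μ) (intSpace μ lam) := by
  obtain ⟨k₀, h0, h1⟩ := containsConst_iff.1 hc
  intro f hf
  obtain ⟨g, rfl⟩ := (cauchyU μ).surjective f
  obtain ⟨k, hk⟩ := cauchyU_mem_intSpace.1 hf
  constructor
  · rw [V_cauchyU, cauchyU_mem_intSpace]
    let a : ℂ := fourierCoeffLp (-1) (g : Lp ℂ 2 μ) - fourierCoeffLp (-1) k
    refine ⟨mulZeta lam k + a • k₀, fun n => ?_⟩
    rw [coe_Z, map_add, map_smul, fourierCoeffLp_mulZeta, fourierCoeffLp_mulZeta]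
    cases n with
    | zero => simp [h0, a]
    | succ n => simp [h1, hk]
  · rw [← (cauchyU μ).apply_symm_apply ((V μ).adjoint (cauchyU μ g)), cauchyU_mem_intSpace]
    refine ⟨(mulZetaEquiv lam ^ (-1 : ℤ)) k, fun n => ?_⟩
    rw [fourierCoeffLp_adjoint_V, fourierCoeffLp_mulZetaEquiv_zpow, sub_neg_eq_add]
    exact_mod_cast hk (n + 1)

end Reducing

section Wold

variable {𝕜 H : Type*} [RCLike 𝕜] [NormedAddCommGroup H] [InnerProductSpace 𝕜 H]
  {U : H ≃ₗᵢ[𝕜] H} {N : Submodule 𝕜 H}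

/-- The wandering subspace `N ⊖ U N` in the Wold decomposition of the restriction of the unitary
`U` to an invariant subspace `N`. -/
def wandering (U : H ≃ₗᵢ[𝕜] H) (N : Submodule 𝕜 H) : Submodule 𝕜 H :=
  N ⊓ (N.map (U.toLinearEquiv : H →ₗ[𝕜] H))ᗮ

theorem pow_apply_mem (hN : ∀ x ∈ N, U x ∈ N) (n : ℕ) {x : H} (hx : x ∈ N) : (U ^ n) x ∈ N := by
  induction n with
  | zero => exact hx
  | succ n ih =>
    rw [pow_succ']
    exact hN _ ih

theorem inner_pow_succ_eq_zero_of_mem_wandering (hN : ∀ x ∈ N, U x ∈ N) {w : H}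
    (hw : w ∈ wandering U N) (n : ℕ) : ⟪w, (U ^ (n + 1)) w⟫_𝕜 = 0 := by
  rw [pow_succ']
  exact Submodule.inner_left_of_mem_orthogonal
    (Submodule.mem_map_of_mem (f := (U.toLinearEquiv : H →ₗ[𝕜] H)) (pow_apply_mem hN n hw.1)) hw.2

variable [N.HasOrthogonalProjection]

theorem exists_apply_eq_of_inner_wandering (hN : ∀ x ∈ N, U x ∈ N) {x : H} (hx : x ∈ N)
    (h : ∀ w ∈ wandering U N, ⟪w, x⟫_𝕜 = 0) : ∃ v ∈ N, U v = x := by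
  let K := N.map (U.toLinearEquiv : H →ₗ[𝕜] H)
  have hKN : K ≤ N := Submodule.map_le_iff_le_comap.2 hN
  have hw : x - K.starProjection x ∈ wandering U N :=
    ⟨N.sub_mem hx (hKN (K.starProjection_apply_mem x)), K.sub_starProjection_mem_orthogonal x⟩
  have hself : ⟪x - K.starProjection x, x - K.starProjection x⟫_𝕜 = 0 := by
    rw [inner_sub_right, h _ hw, zero_sub, neg_eq_zero]
    exact Submodule.inner_left_of_mem_orthogonal (K.starProjection_apply_mem x) hw.2
  rw [inner_self_eq_zero, sub_eq_zero] at hself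
  rw [hself]
  exact K.starProjection_apply_mem x

theorem eq_zero_of_inner_pow_wandering (hN : ∀ x ∈ N, U x ∈ N)
    (hpure : ∀ x, (∀ n : ℕ, ∃ v ∈ N, (U ^ n) v = x) → x = 0) {x : H} (hx : x ∈ N)
    (h : ∀ w ∈ wandering U N, ∀ n : ℕ, ⟪(U ^ n) w, x⟫_𝕜 = 0) : x = 0 := by
  refine hpure x fun n => ?_
  induction n with
  | zero => exact ⟨x, hx, rfl⟩
  | succ n ih =>
    obtain ⟨v, hv, rfl⟩ := ih
    obtain ⟨u, hu, rfl⟩ := exists_apply_eq_of_inner_wandering hN hv fun w hw =>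
      ((U ^ n).inner_map_map w v).symm.trans (h w hw n)
    exact ⟨u, hu, by rw [pow_succ]; rfl⟩

end Wold

section RieszBrothers

theorem eq_smul_circleHaar {ρ : Measure Circle} [IsFiniteMeasure ρ]
    (h : ∀ n : ℤ, n < 0 → ∫ ζ, zetaPow n ζ ∂ρ = 0) : ρ = ρ Set.univ • circleHaar := by
  have hne (n : ℤ) (hn : n ≠ 0) : ∫ ζ, zetaPow n ζ ∂ρ = 0 := by
    rcases hn.lt_or_gt with hn | hn
    · exact h n hn
    · rw [← neg_neg n]
      simp only [← conj_zetaPow (-n)]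
      rw [integral_conj, h (-n) (neg_lt_zero.2 hn), map_zero]
  have := circleHaar.smul_finite (measure_ne_top ρ Set.univ)
  refine measure_ext_of_integral_zetaPow fun n => ?_
  rw [integral_smul_measure]
  rcases eq_or_ne n 0 with rfl | hn
  · simp [zetaPow_zero, Measure.real]
  · rw [hne n hn, integral_zetaPow_circleHaar hn, smul_zero]

variable {μ : Measure Circle} {s : Set Circle}

/-- The measure `|w|² μ`. -/
def sqMeasure (μ : Measure Circle) (w : Lp ℂ 2 μ) : Measure Circle :=
  μ.withDensity fun ζ => ‖w ζ‖ₑ ^ 2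

instance (w : Lp ℂ 2 μ) : IsFiniteMeasure (sqMeasure μ w) := by
  have h := lintegral_rpow_enorm_lt_top_of_eLpNorm_lt_top (by norm_num) (by norm_num)
    (Lp.memLp w).eLpNorm_lt_top
  exact isFiniteMeasure_withDensity (by simpa using h.ne)

theorem aemeasurable_enorm_sq (w : Lp ℂ 2 μ) : AEMeasurable (fun ζ => ‖w ζ‖ₑ ^ 2) μ :=
  (Lp.aestronglyMeasurable w).enorm.pow_const 2

theorem sqMeasure_eq_zero_iff (hs : MeasurableSet s) {w : Lp ℂ 2 μ} :
    sqMeasure μ w s = 0 ↔ indicatorLp ℂ hs w = 0 := by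
  rw [sqMeasure, withDensity_apply_eq_zero' (aemeasurable_enorm_sq w), indicatorLp_eq_zero_iff,
    ae_iff]
  congr! 2
  ext ζ
  simp [and_comm]

variable [IsFiniteMeasure μ]

theorem integral_zetaPow_sqMeasure (w : Lp ℂ 2 μ) (n : ℤ) :
    ∫ ζ, zetaPow n ζ ∂(sqMeasure μ w) = ⟪w, (mulZetaEquiv μ ^ n) w⟫_ℂ := by
  rw [sqMeasure, integral_withDensity_eq_integral_toReal_smul₀ (aemeasurable_enorm_sq w)
    (Filter.Eventually.of_forall fun ζ => by finiteness), L2.inner_def]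
  refine integral_congr_ae ?_
  filter_upwards [coeFn_mulZetaEquiv_zpow n w] with ζ hζ
  rw [hζ, RCLike.inner_apply, mul_assoc, RCLike.mul_conj]
  simp [mul_comm]

theorem sqMeasure_eq_smul_circleHaar {w : Lp ℂ 2 μ}
    (h : ∀ n : ℤ, n < 0 → ⟪w, (mulZetaEquiv μ ^ n) w⟫_ℂ = 0) :
    sqMeasure μ w = sqMeasure μ w Set.univ • circleHaar :=
  eq_smul_circleHaar fun n hn => (integral_zetaPow_sqMeasure w n).trans (h n hn)

theorem indicatorLp_mulZetaEquiv_zpow (hs : MeasurableSet s) (n : ℤ) (h : Lp ℂ 2 μ) :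
    indicatorLp ℂ hs ((mulZetaEquiv μ ^ n) h) = (mulZetaEquiv μ ^ n) (indicatorLp ℂ hs h) := by
  refine Lp.ext ?_
  filter_upwards [coeFn_indicatorLp ℂ hs ((mulZetaEquiv μ ^ n) h), coeFn_mulZetaEquiv_zpow n h,
    coeFn_mulZetaEquiv_zpow n (indicatorLp ℂ hs h), coeFn_indicatorLp ℂ hs h] with ζ h1 h2 h3 h4
  by_cases hζ : ζ ∈ s <;> simp [h1, h2, h3, h4, hζ]

/-- The F. and M. Riesz theorem, in the form that `y μ` has no part singular to Lebesgue measure: by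
the Wold decomposition, `(H²(μ))ᗮ` is generated by vectors `w` for which `|w|² μ` is a multiple of
Lebesgue measure. -/
theorem indicatorLp_eq_zero_of_fourierCoeffLp_natCast (hs : MeasurableSet s)
    (hs0 : circleHaar s = 0) {y : Lp ℂ 2 μ} (hy : ∀ n : ℕ, fourierCoeffLp n y = 0) :
    indicatorLp ℂ hs y = 0 := by
  set U := (mulZetaEquiv μ)⁻¹
  have hU (n : ℕ) : U ^ n = mulZetaEquiv μ ^ (-n : ℤ) := by rw [inv_pow, zpow_neg, zpow_natCast]
  set N := (H2 μ)ᗮ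
  have hN : ∀ x ∈ N, U x ∈ N := fun x hx => mem_orthogonal_H2.2 fun n => by
    rw [← pow_one U, hU, fourierCoeffLp_mulZetaEquiv_zpow, sub_neg_eq_add]
    exact mem_orthogonal_H2.1 hx (n + 1)
  have hpure : ∀ x, (∀ n : ℕ, ∃ v ∈ N, (U ^ n) v = x) → x = 0 := fun x hx =>
    eq_zero_of_fourierCoeffLp fun n => by
      obtain ⟨v, hv, rfl⟩ := hx n.natAbs
      rw [hU, fourierCoeffLp_mulZetaEquiv_zpow, sub_neg_eq_add,
        ← Int.toNat_of_nonneg (a := n + n.natAbs) (by omega)]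
      exact mem_orthogonal_H2.1 hv _
  have hwandering : ∀ w ∈ wandering U N, indicatorLp ℂ hs w = 0 := fun w hw => by
    refine (sqMeasure_eq_zero_iff hs).1 ?_
    rw [sqMeasure_eq_smul_circleHaar fun n hn => ?_, Measure.smul_apply, hs0, smul_zero]
    obtain ⟨m, rfl⟩ := Int.eq_negSucc_of_lt_zero hn
    exact hU (m + 1) ▸ inner_pow_succ_eq_zero_of_mem_wandering hN hw m
  have hproj : N.starProjection (indicatorLp ℂ hs y) = 0 := by
    refine eq_zero_of_inner_pow_wandering hN hpure (N.starProjection_apply_mem _) fun w hw n => ?_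
    rw [← Submodule.inner_starProjection_left_eq_right,
      Submodule.starProjection_eq_self_iff.2 (pow_apply_mem hN n hw.1), ← inner_indicatorLp_left,
      hU, indicatorLp_mulZetaEquiv_zpow, hwandering w hw, map_zero, inner_zero_left]
  have hyN : y ∈ N := mem_orthogonal_H2.2 hy
  rw [← inner_self_eq_zero (𝕜 := ℂ), ← inner_indicatorLp_right,
    ← Submodule.starProjection_eq_self_iff.2 hyN, Submodule.inner_starProjection_left_eq_right,
    Submodule.starProjection_eq_self_iff.2 hyN, hproj, inner_zero_right]

theorem circleHaar_absolutelyContinuous_of_containsConst (hc : ContainsConst μ) :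
    circleHaar ≪ μ := by
  obtain ⟨k, h0, h1⟩ := containsConst_iff.1 hc
  let g : Lp ℂ 2 μ := (H2 μ).orthogonalProjectionOnto k
  have hg (n : ℕ) : fourierCoeffLp n g = fourierCoeffLp n k :=
    fourierCoeffLp_orthogonalProjectionOnto_H2 k n
  have hsq : sqMeasure μ g = sqMeasure μ g Set.univ • circleHaar := by
    refine sqMeasure_eq_smul_circleHaar fun n hn => ?_
    obtain ⟨m, rfl⟩ := Int.eq_negSucc_of_lt_zero hn
    refine Submodule.inner_right_of_mem_orthogonal (K := H2 μ) (Subtype.prop _)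
      (mem_orthogonal_H2.2 fun j => ?_)
    rw [fourierCoeffLp_mulZetaEquiv_zpow, Int.negSucc_eq, sub_neg_eq_add, ← Nat.cast_succ,
      ← Nat.cast_add, hg]
    exact_mod_cast h1 (j + m)
  have hne : sqMeasure μ g Set.univ ≠ 0 := fun h => by
    have hg0 : g = 0 := by
      refine (Lp.eq_zero_iff_ae_eq_zero).2 ?_
      filter_upwards [(indicatorLp_eq_zero_iff ℂ .univ).1 ((sqMeasure_eq_zero_iff .univ).1 h)]
        with ζ hζ using hζ trivial
    simpa [hg0, h0] using hg 0
  refine (Measure.absolutelyContinuous_smul hne).trans ?_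
  rw [← hsq]
  exact withDensity_absolutelyContinuous _ _

end RieszBrothers

section ReducingSupport

variable {μ lam : Measure Circle} [IsFiniteMeasure μ] [IsFiniteMeasure lam] {g : H2 μ}
  {k : Lp ℂ 2 lam}

/-- Otherwise a nonzero constant would be the difference of two elements of `ℋ⁺(λ)`: the Cauchy
transform of `ζ g`, which is in `ℋ⁺(λ)` by invariance, and that of `ζ k`. -/
theorem fourierCoeffLp_neg_one_eq_of_isReducing (hc : ¬ ContainsConst lam)
    (hred : IsReducing (V μ) (intSpace μ lam))
    (e : ∀ n : ℕ, fourierCoeffLp n (g : Lp ℂ 2 μ) = fourierCoeffLp n k) :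
    fourierCoeffLp (-1) (g : Lp ℂ 2 μ) = fourierCoeffLp (-1) k := by
  have hV := (hred _ (cauchyU_mem_intSpace.2 ⟨k, e⟩)).1
  rw [V_cauchyU, cauchyU_mem_intSpace] at hV
  obtain ⟨k', hk'⟩ := hV
  simp only [coe_Z, fourierCoeffLp_mulZeta] at hk'
  by_contra hne
  let a := fourierCoeffLp (-1) (g : Lp ℂ 2 μ) - fourierCoeffLp (-1) k
  refine hc (containsConst_iff.2 ⟨a⁻¹ • (k' - mulZeta lam k), ?_, fun n => ?_⟩)
  · have h0 := hk' 0
    rw [Nat.cast_zero, zero_sub] at h0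
    rw [map_smul, map_sub, fourierCoeffLp_mulZeta, zero_sub, ← h0]
    exact inv_mul_cancel₀ (sub_ne_zero.2 hne)
  · rw [map_smul, map_sub, fourierCoeffLp_mulZeta, ← Nat.cast_succ, ← hk', Nat.cast_succ,
      add_sub_cancel_right, e, sub_self, smul_zero]

theorem fourierCoeffLp_eq_of_isReducing (hc : ¬ ContainsConst lam)
    (hred : IsReducing (V μ) (intSpace μ lam))
    (e : ∀ n : ℕ, fourierCoeffLp n (g : Lp ℂ 2 μ) = fourierCoeffLp n k) (n : ℤ) :
    fourierCoeffLp n (g : Lp ℂ 2 μ) = fourierCoeffLp n k := by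
  obtain ⟨n, rfl | rfl⟩ := n.eq_nat_or_neg
  · exact e n
  induction n generalizing g k with
  | zero => simpa using e 0
  | succ m ih =>
    have hZ (n : ℕ) :
        fourierCoeffLp n (Z μ g : Lp ℂ 2 μ) = fourierCoeffLp n (mulZeta lam k) := by
      rw [coe_Z, fourierCoeffLp_mulZeta, fourierCoeffLp_mulZeta]
      cases n with
      | zero => simpa using fourierCoeffLp_neg_one_eq_of_isReducing hc hred e
      | succ n => simpa using e n
    have hm := ih hZ
    rw [coe_Z, fourierCoeffLp_mulZeta, fourierCoeffLp_mulZeta] at hm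
    rwa [Nat.cast_succ, neg_add, ← sub_eq_add_neg]

theorem indicatorLp_eq_zero_of_mem_intSpace (hred : IsReducing (V μ) (intSpace μ lam))
    {s : Set Circle} (hs : MeasurableSet s) (hs0 : lam s = 0) (hg : cauchyU μ g ∈ intSpace μ lam) :
    indicatorLp ℂ hs (g : Lp ℂ 2 μ) = 0 := by
  obtain ⟨k, e⟩ := cauchyU_mem_intSpace.1 hg
  have hμ : μ ≤ (1 : ℝ≥0∞) • (μ + lam) := by rw [one_smul]; exact Measure.le_add_right le_rfl
  have hlam : lam ≤ (1 : ℝ≥0∞) • (μ + lam) := by rw [one_smul]; exact Measure.le_add_left le_rfl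
  let G := (changeMeasure ℂ ENNReal.one_ne_top hμ).adjoint (g : Lp ℂ 2 μ)
  let K := (changeMeasure ℂ ENNReal.one_ne_top hlam).adjoint k
  have hcoeff (n : ℤ) : fourierCoeffLp n (G - K) =
      fourierCoeffLp n (g : Lp ℂ 2 μ) - fourierCoeffLp n k := by
    rw [map_sub, fourierCoeffLp_adjoint_changeMeasure, fourierCoeffLp_adjoint_changeMeasure]
  have hGK : indicatorLp ℂ hs (G - K) = 0 := by
    by_cases hc : ContainsConst lam
    · exact indicatorLp_eq_zero_of_fourierCoeffLp_natCast hs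
        (circleHaar_absolutelyContinuous_of_containsConst hc hs0) fun n => by
          rw [hcoeff, e, sub_self]
    · have h0 : G - K = 0 := eq_zero_of_fourierCoeffLp fun n => by
        rw [hcoeff, fourierCoeffLp_eq_of_isReducing hc hred e, sub_self]
      rw [h0, map_zero]
  refine eq_zero_of_fourierCoeffLp fun n => ?_
  have hn : ⟪indicatorLp ℂ hs (zetaPowLp (μ + lam) n), G - K⟫_ℂ = 0 := by
    rw [inner_indicatorLp_left, hGK, inner_zero_right]
  rw [inner_sub_right, ContinuousLinearMap.adjoint_inner_right,
    ContinuousLinearMap.adjoint_inner_right, ← indicatorLp_changeMeasure,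
    ← indicatorLp_changeMeasure, changeMeasure_zetaPowLp, changeMeasure_zetaPowLp,
    indicatorLp_eq_zero_of_measure_zero ℂ hs hs0, inner_zero_left, sub_zero] at hn
  rw [fourierCoeffLp_apply, ← inner_indicatorLp_left, hn]

end ReducingSupport

section Inclusion

variable {μ ν lam : Measure Circle} [IsFiniteMeasure μ] [IsFiniteMeasure ν] [IsFiniteMeasure lam]
  {c : ℝ≥0∞}

/-- If `ν ≤ c μ`, then every `ν`-Cauchy transform is a `μ`-Cauchy transform; this is the bounded
inclusion of `ℋ⁺(ν)` into `ℋ⁺(μ)`. -/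
def inclusion (hc : c ≠ ∞) (h : ν ≤ c • μ) : HPlus ν →L[ℂ] HPlus μ :=
  (cauchyU μ).toContinuousLinearEquiv.toContinuousLinearMap ∘L (H2 μ).orthogonalProjectionOnto ∘L
    (changeMeasure ℂ hc h).adjoint ∘L (H2 ν).subtypeL ∘L
      (cauchyU ν).symm.toContinuousLinearEquiv.toContinuousLinearMap

theorem inclusion_cauchyU (hc : c ≠ ∞) (h : ν ≤ c • μ) (g : H2 ν) :
    inclusion hc h (cauchyU ν g) = cauchyU μ
      ((H2 μ).orthogonalProjectionOnto ((changeMeasure ℂ hc h).adjoint (g : Lp ℂ 2 ν))) := by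
  simp [inclusion]

theorem coe_inclusion (hc : c ≠ ∞) (h : ν ≤ c • μ) (f : HPlus ν) :
    (inclusion hc h f : 𝔻 → ℂ) = f := by
  obtain ⟨g, rfl⟩ := (cauchyU ν).surjective f
  rw [inclusion_cauchyU]
  exact cauchyFun_eq_cauchyFun_iff.2 fun n => by
    rw [fourierCoeffLp_orthogonalProjectionOnto_H2, fourierCoeffLp_adjoint_changeMeasure]

theorem rkAbsolutelyContinuous_of_absolutelyContinuous (h : μ ≪ lam) :
    RKAbsolutelyContinuous μ lam := by
  obtain ⟨A, hA, hle, hcover⟩ := exists_restrict_le_natCast_smul h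
  rw [RKAbsolutelyContinuous, Submodule.dense_iff_topologicalClosure_eq_top,
    Submodule.topologicalClosure_eq_top_iff, Submodule.eq_bot_iff]
  intro f hf
  obtain ⟨g, rfl⟩ := (cauchyU μ).surjective f
  have hvanish (m : ℕ) : indicatorLp ℂ (hA m) (g : Lp ℂ 2 μ) = 0 := by
    let x := indicatorLp ℂ (hA m) (g : Lp ℂ 2 μ)
    have hint : cauchyU μ ((H2 μ).orthogonalProjectionOnto x) ∈ intSpace μ lam :=
      cauchyU_orthogonalProjectionOnto_mem_intSpace
        (k := (changeMeasure ℂ (ENNReal.natCast_ne_top m) (hle m)).adjoint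
          (LpToLpRestrictCLM Circle ℂ ℂ μ 2 (A m) g))
        fun n => (fourierCoeffLp_extendLp (hA m) n _).trans
          (fourierCoeffLp_adjoint_changeMeasure _ _ n _).symm
    have horth : ⟪x, (g : Lp ℂ 2 μ)⟫_ℂ = 0 := by
      rw [← Submodule.inner_orthogonalProjectionOnto_eq_of_mem_right g x]
      exact (inner_cauchyU μ _ g).symm.trans (hf _ hint)
    rw [inner_indicatorLp_left, inner_indicatorLp_right] at horth
    exact inner_self_eq_zero.1 horth
  have hg : (g : Lp ℂ 2 μ) = 0 := by
    rw [Lp.eq_zero_iff_ae_eq_zero]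
    filter_upwards [hcover, ae_all_iff.2 fun m => (indicatorLp_eq_zero_iff ℂ (hA m)).1 (hvanish m)]
      with ζ ⟨m, hm⟩ hζ using hζ m hm
  have hg0 : g = 0 := Subtype.ext hg
  rw [hg0, map_zero]

theorem range_of_isInclusion {e : HPlus ν →ₗᵢ[ℂ] HPlus μ} (he : IsInclusion e) :
    LinearMap.range e.toLinearMap = intSpace μ ν := by
  ext f
  rw [mem_intSpace]
  refine exists_congr fun k => ?_
  rw [← he k]
  exact DFunLike.coe_injective.eq_iff.symm

theorem range_eq_topologicalClosure_intSpace {e : HPlus ν →ₗᵢ[ℂ] HPlus μ} (he : IsInclusion e)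
    (hrk : RKAbsolutelyContinuous ν lam) (hle : intSpace μ lam ≤ LinearMap.range e.toLinearMap) :
    LinearMap.range e.toLinearMap = (intSpace μ lam).topologicalClosure := by
  refine le_antisymm ?_
    (Submodule.topologicalClosure_minimal _ hle e.isometry.isClosedEmbedding.isClosed_range)
  rintro _ ⟨f, rfl⟩
  refine map_mem_closure e.continuous (hrk f) fun f' hf' => ?_
  obtain ⟨k, hk⟩ := mem_intSpace.1 hf'
  exact mem_intSpace.2 ⟨k, hk.trans (he f').symm⟩

theorem rkSingular_of_isOrtho_range {j : HPlus ν →ₗᵢ[ℂ] HPlus μ} (hj : IsInclusion j)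
    (horth : intSpace μ lam ⟂ LinearMap.range j.toLinearMap) : RKSingular ν lam := by
  refine (Submodule.eq_bot_iff _).2 fun f hf => ?_
  obtain ⟨k, hk⟩ := mem_intSpace.1 hf
  have hjf : j f ∈ intSpace μ lam := mem_intSpace.2 ⟨k, hk.trans (hj f).symm⟩
  exact (map_eq_zero_iff j j.injective).1 (horth.disjoint.eq_bot.le ⟨hjf, f, rfl⟩)

theorem intSpace_restrict_sup_intSpace_restrict_compl {s : Set Circle} (hs : MeasurableSet s) :
    intSpace μ (μ.restrict s) ⊔ intSpace μ (μ.restrict sᶜ) = ⊤ := by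
  refine eq_top_iff.2 fun f _ => ?_
  obtain ⟨g, rfl⟩ := (cauchyU μ).surjective f
  have hg : (H2 μ).orthogonalProjectionOnto (indicatorLp ℂ hs (g : Lp ℂ 2 μ)) +
      (H2 μ).orthogonalProjectionOnto (indicatorLp ℂ hs.compl (g : Lp ℂ 2 μ)) = g := by
    rw [← map_add, indicatorLp_add_indicatorLp_compl,
      Submodule.orthogonalProjectionOnto_mem_subspace_eq_self]
  rw [← hg, map_add]
  exact Submodule.add_mem_sup
    (cauchyU_orthogonalProjectionOnto_mem_intSpace fun n => fourierCoeffLp_extendLp hs n _)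
    (cauchyU_orthogonalProjectionOnto_mem_intSpace fun n => fourierCoeffLp_extendLp hs.compl n _)

end Inclusion

section InvariantIndicator

variable {μ : Measure Circle} [IsFiniteMeasure μ] {s : Set Circle}

theorem indicatorLp_compl_mem_H2 (hs : MeasurableSet s)
    (hinv : ∀ f ∈ H2 μ, indicatorLp ℂ hs f ∈ H2 μ) :
    ∀ f ∈ H2 μ, indicatorLp ℂ hs.compl f ∈ H2 μ := fun f hf => by
  rw [← add_sub_cancel_left (indicatorLp ℂ hs f) (indicatorLp ℂ hs.compl f),
    indicatorLp_add_indicatorLp_compl]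
  exact sub_mem hf (hinv f hf)

theorem extendLp_mem_H2 (hs : MeasurableSet s) (hinv : ∀ f ∈ H2 μ, indicatorLp ℂ hs f ∈ H2 μ)
    {g : Lp ℂ 2 (μ.restrict s)} (hg : g ∈ H2 (μ.restrict s)) : extendLp ℂ hs g ∈ H2 μ := by
  rw [← (H2 μ).orthogonal_orthogonal]
  intro x hx
  rw [inner_extendLp_right]
  refine Submodule.inner_left_of_mem_orthogonal hg (mem_orthogonal_H2.2 fun n => ?_)
  calc fourierCoeffLp n (LpToLpRestrictCLM Circle ℂ ℂ μ 2 s x)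
      = fourierCoeffLp n (indicatorLp ℂ hs x) := (fourierCoeffLp_extendLp hs n _).symm
    _ = ⟪indicatorLp ℂ hs (zetaPowLp μ n), x⟫_ℂ := by
      rw [fourierCoeffLp_apply, inner_indicatorLp_left]
    _ = 0 := hx _ (hinv _ (zetaPowLp_natCast_mem_H2 n))

theorem exists_isInclusion_restrict (hs : MeasurableSet s)
    (hinv : ∀ f ∈ H2 μ, indicatorLp ℂ hs f ∈ H2 μ) :
    ∃ e : HPlus (μ.restrict s) →ₗᵢ[ℂ] HPlus μ, IsInclusion e := by
  have hle : μ.restrict s ≤ (1 : ℝ≥0∞) • μ := by rw [one_smul]; exact Measure.restrict_le_self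
  have hadj (g : Lp ℂ 2 (μ.restrict s)) :
      (changeMeasure ℂ ENNReal.one_ne_top hle).adjoint g = extendLp ℂ hs g :=
    sub_eq_zero.1 <| eq_zero_of_fourierCoeffLp fun n => by
      rw [map_sub, fourierCoeffLp_adjoint_changeMeasure, fourierCoeffLp_extendLp, sub_self]
  have hnorm (f : HPlus (μ.restrict s)) : ‖inclusion ENNReal.one_ne_top hle f‖ = ‖f‖ := by
    obtain ⟨g, rfl⟩ := (cauchyU (μ.restrict s)).surjective f
    rw [inclusion_cauchyU, hadj, (cauchyU μ).norm_map, (cauchyU (μ.restrict s)).norm_map,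
      (H2 μ).orthogonalProjectionOnto_mem_subspace_eq_self ⟨_, extendLp_mem_H2 hs hinv g.2⟩]
    exact (extendLp ℂ hs).norm_map (g : Lp ℂ 2 (μ.restrict s))
  exact ⟨⟨(inclusion ENNReal.one_ne_top hle).toLinearMap, hnorm⟩,
    coe_inclusion ENNReal.one_ne_top hle⟩

theorem exists_extendLp_eq_of_mem_intSpace_restrict (hs : MeasurableSet s)
    (hinv : ∀ f ∈ H2 μ, indicatorLp ℂ hs f ∈ H2 μ) {g : H2 μ}
    (hg : cauchyU μ g ∈ intSpace μ (μ.restrict s)) :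
    ∃ k : Lp ℂ 2 (μ.restrict s), extendLp ℂ hs k = g := by
  obtain ⟨k, e⟩ := cauchyU_mem_intSpace.1 hg
  let q := (H2 (μ.restrict s)).orthogonalProjectionOnto k
  have hmem : extendLp ℂ hs (q : Lp ℂ 2 (μ.restrict s)) - g ∈ H2 μ :=
    sub_mem (extendLp_mem_H2 hs hinv q.2) g.2
  have horth : extendLp ℂ hs (q : Lp ℂ 2 (μ.restrict s)) - g ∈ (H2 μ)ᗮ :=
    mem_orthogonal_H2.2 fun n => by
      rw [map_sub, fourierCoeffLp_extendLp, fourierCoeffLp_orthogonalProjectionOnto_H2, e, sub_self]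
  exact ⟨q, sub_eq_zero.1 ((H2 μ).orthogonal_disjoint.eq_bot.le ⟨hmem, horth⟩)⟩

theorem isOrtho_intSpace_restrict (hs : MeasurableSet s)
    (hinv : ∀ f ∈ H2 μ, indicatorLp ℂ hs f ∈ H2 μ) :
    intSpace μ (μ.restrict s) ⟂ intSpace μ (μ.restrict sᶜ) := by
  rw [Submodule.isOrtho_iff_inner_eq]
  intro f hf f' hf'
  obtain ⟨g, rfl⟩ := (cauchyU μ).surjective f
  obtain ⟨g', rfl⟩ := (cauchyU μ).surjective f'
  obtain ⟨k, hk⟩ := exists_extendLp_eq_of_mem_intSpace_restrict hs hinv hf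
  obtain ⟨k', hk'⟩ := exists_extendLp_eq_of_mem_intSpace_restrict hs.compl
    (indicatorLp_compl_mem_H2 hs hinv) hf'
  rw [inner_cauchyU, ← hk, ← hk', inner_extendLp_extendLp_compl]

end InvariantIndicator

section Decomposition

variable {μ ν lam : Measure Circle} [IsFiniteMeasure μ] [IsFiniteMeasure ν] [IsFiniteMeasure lam]
  {s : Set Circle}

theorem indicatorLp_eq_zero_of_rkAbsolutelyContinuous {c : ℝ≥0∞} (hc : c ≠ ∞) (h : ν ≤ c • μ)
    (hred : IsReducing (V μ) (intSpace μ lam)) (hrk : RKAbsolutelyContinuous ν lam)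
    (hs : MeasurableSet s) (hs0 : lam s = 0) {g : H2 μ} (hg : cauchyU μ g ∈ intSpace μ ν) :
    indicatorLp ℂ hs (g : Lp ℂ 2 μ) = 0 := by
  obtain ⟨f, hf⟩ := mem_intSpace.1 hg
  have hfg : inclusion hc h f = cauchyU μ g :=
    DFunLike.coe_injective ((coe_inclusion hc h f).trans hf)
  let T : HPlus ν →L[ℂ] Lp ℂ 2 μ := indicatorLp ℂ hs ∘L (H2 μ).subtypeL ∘L
    (cauchyU μ).symm.toContinuousLinearEquiv.toContinuousLinearMap ∘L inclusion hc h
  have hT : ∀ f' : HPlus ν, T f' = indicatorLp ℂ hs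
      ((cauchyU μ).symm (inclusion hc h f') : Lp ℂ 2 μ) := fun _ => rfl
  have hT0 : (T : HPlus ν → Lp ℂ 2 μ) = fun _ => 0 := by
    refine T.continuous.ext_on hrk continuous_const fun f' hf' => ?_
    obtain ⟨k, hk⟩ := mem_intSpace.1 hf'
    refine indicatorLp_eq_zero_of_mem_intSpace hred hs hs0 ?_
    exact mem_intSpace.2 ⟨k, hk.trans ((congrArg _ ((cauchyU μ).apply_symm_apply _)).trans
      (coe_inclusion hc h f')).symm⟩
  rw [← (cauchyU μ).symm_apply_apply g, ← hfg, ← hT, hT0]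

theorem indicatorLp_mem_H2_of_isReducing (hred : IsReducing (V μ) (intSpace μ lam))
    (hs : MeasurableSet s) (hs0 : lam sᶜ = 0) (hac : μ.restrict s ≪ lam) :
    ∀ f ∈ H2 μ, indicatorLp ℂ hs f ∈ H2 μ := by
  intro f hf
  set x := indicatorLp ℂ hs f
  let a := (H2 μ).orthogonalProjectionOnto x
  have hle : μ.restrict s ≤ (1 : ℝ≥0∞) • μ := by rw [one_smul]; exact Measure.restrict_le_self
  have ha : indicatorLp ℂ hs.compl (a : Lp ℂ 2 μ) = 0 :=
    indicatorLp_eq_zero_of_rkAbsolutelyContinuous ENNReal.one_ne_top hle hred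
      (rkAbsolutelyContinuous_of_absolutelyContinuous hac) hs.compl hs0
      (cauchyU_orthogonalProjectionOnto_mem_intSpace fun n => fourierCoeffLp_extendLp hs n _)
  have hxa : indicatorLp ℂ hs (x - (a : Lp ℂ 2 μ)) = x - (a : Lp ℂ 2 μ) := by
    have hcompl : indicatorLp ℂ hs.compl (x - (a : Lp ℂ 2 μ)) = 0 := by
      rw [map_sub, ha, sub_zero]
      exact indicatorLp_compl_extendLp ℂ hs _
    have hadd := indicatorLp_add_indicatorLp_compl ℂ hs (x - (a : Lp ℂ 2 μ))
    rwa [hcompl, add_zero] at hadd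
  have horth : x - (a : Lp ℂ 2 μ) ∈ (H2 μ)ᗮ := (H2 μ).sub_starProjection_mem_orthogonal x
  have hzero : ⟪x - (a : Lp ℂ 2 μ), x - (a : Lp ℂ 2 μ)⟫_ℂ = 0 := by
    rw [inner_sub_right, Submodule.inner_left_of_mem_orthogonal a.2 horth, sub_zero,
      ← inner_indicatorLp_left, hxa, Submodule.inner_left_of_mem_orthogonal hf horth]
  rw [sub_eq_zero.1 (inner_self_eq_zero.1 hzero)]
  exact a.2

theorem intSpace_le_intSpace_restrict (hred : IsReducing (V μ) (intSpace μ lam))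
    (hs : MeasurableSet s) (hs0 : lam sᶜ = 0) : intSpace μ lam ≤ intSpace μ (μ.restrict s) := by
  intro f hf
  obtain ⟨g, rfl⟩ := (cauchyU μ).surjective f
  have hg := indicatorLp_add_indicatorLp_compl ℂ hs (g : Lp ℂ 2 μ)
  rw [indicatorLp_eq_zero_of_mem_intSpace hred hs.compl hs0 hf, add_zero] at hg
  refine cauchyU_mem_intSpace.2 ⟨LpToLpRestrictCLM Circle ℂ ℂ μ 2 s g, fun n => ?_⟩
  exact (congrArg _ hg.symm).trans (fourierCoeffLp_extendLp hs n _)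

theorem measure_eq_zero_of_rkAbsolutelyContinuous {c : ℝ≥0∞} (hc : c ≠ ∞) (h : ν ≤ c • μ)
    (hred : IsReducing (V μ) (intSpace μ lam)) (hrk : RKAbsolutelyContinuous ν lam)
    (hs : MeasurableSet s) (hs0 : lam s = 0) (hinv : ∀ f ∈ H2 μ, indicatorLp ℂ hs f ∈ H2 μ) :
    ν s = 0 := by
  let y := (changeMeasure ℂ hc h).adjoint (zetaPowLp ν 0)
  have hy : indicatorLp ℂ hs ((H2 μ).orthogonalProjectionOnto y : Lp ℂ 2 μ) = 0 :=
    indicatorLp_eq_zero_of_rkAbsolutelyContinuous hc h hred hrk hs hs0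
      (cauchyU_orthogonalProjectionOnto_mem_intSpace fun n =>
        fourierCoeffLp_adjoint_changeMeasure hc h n _)
  let u : H2 μ := ⟨indicatorLp ℂ hs (zetaPowLp μ 0), hinv _ (zetaPowLp_natCast_mem_H2 0)⟩
  have hreal : (ν.real s : ℂ) = 0 := calc
    (ν.real s : ℂ) = ⟪indicatorLp ℂ hs (zetaPowLp ν 0), zetaPowLp ν 0⟫_ℂ :=
      (inner_indicatorLp_zetaPowLp_zero hs).symm
    _ = ⟪(u : Lp ℂ 2 μ), y⟫_ℂ := by
      rw [ContinuousLinearMap.adjoint_inner_right, ← indicatorLp_changeMeasure,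
        changeMeasure_zetaPowLp]
    _ = ⟪(u : Lp ℂ 2 μ), ((H2 μ).orthogonalProjectionOnto y : Lp ℂ 2 μ)⟫_ℂ :=
      (Submodule.inner_orthogonalProjectionOnto_eq_of_mem_left u y).symm
    _ = 0 := by rw [inner_indicatorLp_left, hy, inner_zero_right]
  exact (measureReal_eq_zero_iff).1 (Complex.ofReal_eq_zero.1 hreal)

end Decomposition

section Analysis

theorem weighted_norm_sq_identity {E : Type*} [NormedAddCommGroup E] [InnerProductSpace ℝ E]
    {a b : ℝ} (hab : a + b = 1) (x y : E) :
    a * ‖x‖ ^ 2 + b * ‖y‖ ^ 2 = ‖a • x + b • y‖ ^ 2 + a * b * ‖x - y‖ ^ 2 := by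
  obtain rfl : b = 1 - a := by linarith
  simp only [norm_add_sq_real, norm_sub_sq_real, norm_smul, real_inner_smul_left,
    real_inner_smul_right, mul_pow, Real.norm_eq_abs, sq_abs]
  ring

theorem norm_sub_smul_comm {E : Type*} [NormedAddCommGroup E] [InnerProductSpace ℝ E]
    {x y : E} (hxy : ‖x‖ = ‖y‖) (r : ℝ) : ‖x - r • y‖ = ‖y - r • x‖ := by
  rw [← sq_eq_sq₀ (norm_nonneg _) (norm_nonneg _), norm_sub_sq_real, norm_sub_sq_real, norm_smul,
    norm_smul, hxy, real_inner_smul_right, real_inner_smul_right, real_inner_comm]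

theorem exists_mem_orthogonal_inner_eq_one {𝕜 E : Type*} [RCLike 𝕜] [NormedAddCommGroup E]
    [InnerProductSpace 𝕜 E] [CompleteSpace E] {K : Submodule 𝕜 E} {x : E}
    (hx : x ∉ K.topologicalClosure) : ∃ k ∈ Kᗮ, ⟪x, k⟫_𝕜 = 1 := by
  rw [← K.orthogonal_orthogonal_eq_closure, Submodule.mem_orthogonal'] at hx
  push Not at hx
  obtain ⟨k, hk, hne⟩ := hx
  exact ⟨(⟪x, k⟫_𝕜)⁻¹ • k, Kᗮ.smul_mem _ hk, by rw [inner_smul_right, inv_mul_cancel₀ hne]⟩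

theorem exists_eq_pow_smul_of_differentiableOn {E : Type*} [NormedAddCommGroup E] [NormedSpace ℂ E]
    [CompleteSpace E] {U : Set ℂ} {c : ℂ} {f : ℂ → E} (hU : IsOpen U) (hU' : IsPreconnected U)
    (hc : c ∈ U) (hf : DifferentiableOn ℂ f U) (hne : ∃ z ∈ U, f z ≠ 0) :
    ∃ (k : ℕ) (g : ℂ → E), DifferentiableOn ℂ g U ∧ g c ≠ 0 ∧ ∀ z, f z = (z - c) ^ k • g z := by
  have hfa := hf.analyticOnNhd hU
  obtain ⟨p, hp⟩ := hfa c hc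
  have hp0 : p ≠ 0 := by
    rintro rfl
    obtain ⟨z, hz, hfz⟩ := hne
    exact hfz (hfa.eqOn_zero_of_preconnected_of_eventuallyEq_zero hU' hc hp.eventually_eq_zero hz)
  have hdiff (n : ℕ) : DifferentiableOn ℂ ((Function.swap dslope c)^[n] f) U := by
    induction n with
    | zero => exact hf
    | succ n ih =>
      rw [Function.iterate_succ_apply']
      exact (Complex.differentiableOn_dslope (hU.mem_nhds hc)).2 ih
  exact ⟨p.order, _, hdiff _, hp.iterate_dslope_fslope_ne_zero hp0,
    hp.eq_pow_order_mul_iterate_dslope⟩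

theorem norm_circleAverage_le {E : Type*} [NormedAddCommGroup E] [NormedSpace ℝ E] (f : ℂ → E)
    (c : ℂ) (R : ℝ) :
    ‖Real.circleAverage f c R‖ ≤ Real.circleAverage (fun z => ‖f z‖) c R := by
  rw [Real.circleAverage_def, Real.circleAverage_def, norm_smul,
    Real.norm_of_nonneg (by positivity), smul_eq_mul]
  gcongr
  exact intervalIntegral.norm_integral_le_integral_norm (by positivity)

theorem norm_sq_le_circleAverage_norm_sq {f : ℂ → ℂ} {c : ℂ} {R : ℝ}
    (hf : DiffContOnCl ℂ f (Metric.ball c |R|)) :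
    ‖f c‖ ^ 2 ≤ Real.circleAverage (fun z => ‖f z‖ ^ 2) c R := by
  calc ‖f c‖ ^ 2 = ‖Real.circleAverage (fun z => f z • f z) c R‖ := by
        rw [(hf.smul hf).circleAverage, norm_smul, sq]
    _ ≤ Real.circleAverage (fun z => ‖f z • f z‖) c R := norm_circleAverage_le _ c R
    _ = Real.circleAverage (fun z => ‖f z‖ ^ 2) c R := by simp only [norm_smul, sq]

theorem circleAverage_integral_swap {α E : Type*} [TopologicalSpace α] [CompactSpace α]
    [T2Space α] [SecondCountableTopology α] [MeasurableSpace α] [OpensMeasurableSpace α]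
    [NormedAddCommGroup E] [NormedSpace ℝ E] {μ : Measure α} [IsFiniteMeasure μ]
    {f : ℂ → α → E} {c : ℂ} {R : ℝ}
    (hf : ContinuousOn (Function.uncurry f) (Metric.sphere c |R| ×ˢ Set.univ)) :
    Real.circleAverage (fun z => ∫ x, f z x ∂μ) c R =
      ∫ x, Real.circleAverage (fun z => f z x) c R ∂μ := by
  have hcont : Continuous (Function.uncurry fun θ x => f (circleMap c R θ) x) :=
    hf.comp_continuous (f := fun p : ℝ × α => (circleMap c R p.1, p.2)) (by fun_prop)
      fun p => ⟨circleMap_mem_sphere' c R p.1, Set.mem_univ _⟩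
  have hint := (hcont.continuousOn.integrableOn_compact (μ := volume.prod μ)
    (isCompact_uIcc.prod isCompact_univ)).mono_set
      (Set.prod_mono_left (t := Set.univ) (Set.uIoc_subset_uIcc (a := 0) (b := 2 * Real.pi)))
  rw [IntegrableOn, ← Measure.prod_restrict, Measure.restrict_univ] at hint
  simp only [Real.circleAverage_def]
  rw [intervalIntegral_integral_swap hint, integral_smul]

theorem exists_re_eval_eq_norm_sq (q : ℂ[X]) :
    ∃ Q : ℂ[X], ∀ z : ℂ, ‖z‖ = 1 → (Q.eval z).re = ‖q.eval z‖ ^ 2 := by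
  induction q using Polynomial.recOnHorner with
  | M0 => exact ⟨0, by simp⟩
  | MC p a _ _ ih =>
    obtain ⟨Q, hQ⟩ := ih
    refine ⟨Q + Polynomial.C (2 * conj a) * p + Polynomial.C (a * conj a), fun z hz => ?_⟩
    simp only [eval_add, eval_mul, eval_C, Complex.add_re, hQ z hz, ← Complex.normSq_eq_norm_sq,
      Complex.normSq_apply, Complex.mul_re, Complex.mul_im, Complex.conj_re, Complex.conj_im,
      Complex.re_ofNat, Complex.im_ofNat, Complex.add_im]
    ring
  | MX p _ ih =>
    obtain ⟨Q, hQ⟩ := ih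
    exact ⟨Q, fun z hz => by rw [hQ z hz, eval_mul, eval_X, norm_mul, hz, mul_one]⟩

end Analysis

section Herglotz

/-- The Herglotz–Riesz transform of a measure on the circle as a function of a complex variable; for
`ζ` on the circle, the integrand `(1 + zζ̄) / (1 - zζ̄)` of `herglotz` is `(ζ + z) / (ζ - z)`, the
kernel `herglotzRieszKernel 0 z ζ`. -/
def herglotzC (lam : Measure Circle) (z : ℂ) : ℂ :=
  ∫ ζ : Circle, herglotzRieszKernel 0 z ζ ∂lam

theorem herglotz_eq_herglotzC (lam : Measure Circle) (z : 𝔻) :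
    herglotz lam z = herglotzC lam z := by
  refine integral_congr_ae (.of_forall fun ζ => ?_)
  have hζ : (ζ : ℂ) * conj (ζ : ℂ) = 1 := by
    rw [Complex.mul_conj, Circle.normSq_coe, Complex.ofReal_one]
  beta_reduce
  rw [herglotzRieszKernel_def, ← mul_div_mul_left _ _ ζ.coe_ne_zero]
  congr 1
  · linear_combination (z : ℂ) * hζ
  · linear_combination -(z : ℂ) * hζ

theorem integrable_herglotzRieszKernel (lam : Measure Circle) [IsFiniteMeasure lam] {z : ℂ}
    (hz : z ∈ Metric.ball 0 1) :
    Integrable (fun ζ : Circle => herglotzRieszKernel 0 z ζ) lam := by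
  refine Continuous.integrable_of_hasCompactSupport ?_ (.of_compactSpace _)
  exact (continuousOn_herglotzRieszKernel_sphere hz).comp_continuous continuous_circle_coe
    fun ζ => by rw [abs_one, mem_sphere_zero_iff_norm, Circle.norm_coe]

variable (lam : Measure Circle) [IsFiniteMeasure lam]

theorem herglotzC_eq_resolventTransform {z : ℂ} (hz : z ∈ Metric.ball 0 1) :
    herglotzC lam z = lam.real Set.univ + 2 * z * resolventTransform (lam.map zeta) z := by
  have hne (ζ : Circle) : (ζ : ℂ) - z ≠ 0 := by
    rw [sub_ne_zero]
    rintro rfl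
    rw [mem_ball_zero_iff, Circle.norm_coe] at hz
    exact hz.false
  have hker (ζ : Circle) : 2 * z * resolvent z (ζ : ℂ) = herglotzRieszKernel 0 z ζ - 1 := by
    rw [herglotzRieszKernel_def, resolvent, Ring.inverse_eq_inv', Algebra.algebraMap_self_apply,
      sub_zero, sub_zero]
    field_simp [hne ζ]
    ring
  have hres : AEStronglyMeasurable (resolvent z) (lam.map zeta) :=
    measurable_resolvent.aestronglyMeasurable
  rw [resolventTransform, integral_map zeta.continuous.aemeasurable hres, ← integral_const_mul]
  simp only [zeta_apply, hker]
  rw [integral_sub (integrable_herglotzRieszKernel lam hz) (integrable_const _), integral_const,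
    herglotzC, Complex.real_smul, mul_one, add_sub_cancel]

theorem differentiableOn_herglotzC : DifferentiableOn ℂ (herglotzC lam) (Metric.ball 0 1) := by
  have hsupp : (lam.map zeta).support ⊆ Metric.sphere (0 : ℂ) 1 := by
    refine Measure.support_subset_of_isClosed Metric.isClosed_sphere ?_
    rw [mem_ae_map_iff zeta.continuous.aemeasurable Metric.isClosed_sphere.measurableSet]
    exact Filter.univ_mem' fun ζ => mem_sphere_zero_iff_norm.2 ζ.norm_coe
  have hdiff : DifferentiableOn ℂ (resolventTransform (lam.map zeta)) (Metric.ball (0 : ℂ) 1) := by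
    intro z hz
    refine (hasDerivAt_resolventTransform z ?_).differentiableAt.differentiableWithinAt
    rintro ⟨w, hw, rfl⟩
    exact Metric.sphere_disjoint_ball.notMem_of_mem_left (hsupp hw) hz
  refine DifferentiableOn.congr ?_ fun z hz => herglotzC_eq_resolventTransform lam hz
  fun_prop

theorem re_herglotzC {z : ℂ} (hz : z ∈ Metric.ball 0 1) :
    (herglotzC lam z).re = ∫ ζ : Circle, poissonKernel 0 z ζ ∂lam := by
  rw [herglotzC, ← RCLike.re_eq_complex_re, ← integral_re (integrable_herglotzRieszKernel lam hz)]
  simp only [poissonKernel_eq_re_herglotzRieszKernel, Function.comp_apply, RCLike.re_eq_complex_re]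

theorem re_herglotzC_nonneg {z : ℂ} (hz : z ∈ Metric.ball 0 1) : 0 ≤ (herglotzC lam z).re := by
  rw [re_herglotzC lam hz]
  refine integral_nonneg fun ζ => div_nonneg ?_ (by positivity)
  rw [mem_ball_zero_iff] at hz
  rw [sub_zero, sub_zero, Circle.norm_coe, sub_nonneg]
  gcongr

theorem herglotzC_add_one_ne_zero {z : ℂ} (hz : z ∈ Metric.ball 0 1) : herglotzC lam z + 1 ≠ 0 := by
  intro h
  have hre := congrArg Complex.re h
  rw [Complex.add_re, Complex.one_re, Complex.zero_re] at hre
  linarith [re_herglotzC_nonneg lam hz]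

theorem one_sub_norm_sq_cayley {w : ℂ} (hw : w + 1 ≠ 0) :
    1 - ‖(w - 1) / (w + 1)‖ ^ 2 = 4 * w.re / ‖w + 1‖ ^ 2 := by
  have hpos : ‖w + 1‖ ^ 2 ≠ 0 := pow_ne_zero 2 (norm_ne_zero_iff.2 hw)
  rw [norm_div, div_pow, eq_div_iff hpos, sub_mul, one_mul, div_mul_cancel₀ _ hpos,
    ← Complex.normSq_eq_norm_sq, ← Complex.normSq_eq_norm_sq, Complex.normSq_add,
    Complex.normSq_sub, map_one, map_one, mul_one]
  ring

theorem clark_mem_contractiveAnalytic : clark lam ∈ contractiveAnalytic := by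
  refine ⟨⟨fun z => (herglotzC lam z - 1) / (herglotzC lam z + 1), ?_, fun z => ?_⟩, fun z => ?_⟩
  · exact ((differentiableOn_herglotzC lam).sub_const 1).div
      ((differentiableOn_herglotzC lam).add_const 1) fun z hz => herglotzC_add_one_ne_zero lam hz
  · rw [clark, herglotz_eq_herglotzC]
  · have hz : (z : ℂ) ∈ Metric.ball 0 1 := mem_ball_zero_iff.2 z.norm_lt_one
    rw [clark, herglotz_eq_herglotzC, ← sq_le_one_iff₀ (norm_nonneg _), ← sub_nonneg,
      one_sub_norm_sq_cayley (herglotzC_add_one_ne_zero lam hz)]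
    have := re_herglotzC_nonneg lam hz
    positivity

theorem exists_norm_sq_add_norm_sq_le_one {b : 𝔻 → ℂ} (hb : b ∈ contractiveAnalytic)
    (hext : b ∉ Set.extremePoints ℝ contractiveAnalytic) :
    ∃ F : ℂ → ℂ, DifferentiableOn ℂ F (Metric.ball 0 1) ∧ (∃ z : 𝔻, F z ≠ 0) ∧
      ∀ z : 𝔻, ‖b z‖ ^ 2 + ‖F z‖ ^ 2 ≤ 1 := by
  rw [mem_extremePoints_iff_left, not_and] at hext
  have hsplit := hext hb
  push Not at hsplit
  obtain ⟨x, ⟨⟨F₁, hF₁, hxF⟩, hx⟩, y, ⟨⟨F₂, hF₂, hyF⟩, hy⟩, ⟨s, t, hs, ht, hst, rfl⟩, hne⟩ := hsplit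
  have hpos : 0 < s * t := mul_pos hs ht
  have hxy : x ≠ y := by
    rintro rfl
    rw [← add_smul, hst, one_smul] at hne
    exact hne rfl
  obtain ⟨z₀, hz₀⟩ := Function.ne_iff.1 hxy
  refine ⟨fun z => √(s * t) • (F₁ z - F₂ z), by fun_prop, ⟨z₀, ?_⟩, fun z => ?_⟩
  · beta_reduce
    rw [← hxF, ← hyF]
    exact smul_ne_zero (Real.sqrt_pos.2 hpos).ne' (sub_ne_zero.2 hz₀)
  · beta_reduce
    rw [← hxF, ← hyF, norm_smul, mul_pow, Real.norm_eq_abs, sq_abs, Real.sq_sqrt hpos.le]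
    calc ‖(s • x + t • y) z‖ ^ 2 + s * t * ‖x z - y z‖ ^ 2 = s * ‖x z‖ ^ 2 + t * ‖y z‖ ^ 2 :=
          (weighted_norm_sq_identity hst (x z) (y z)).symm
      _ ≤ s * 1 + t * 1 := by
          gcongr <;> exact pow_le_one₀ (norm_nonneg _) (by first | exact hx z | exact hy z)
      _ = 1 := by rw [mul_one, mul_one, hst]

theorem exists_norm_sq_le_re_herglotzC (h : ¬ IsExtremeMeasure lam) :
    ∃ G : ℂ → ℂ, DifferentiableOn ℂ G (Metric.ball 0 1) ∧ (∃ z ∈ Metric.ball 0 1, G z ≠ 0) ∧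
      ∀ z ∈ Metric.ball 0 1, ‖G z‖ ^ 2 ≤ (herglotzC lam z).re := by
  obtain ⟨F, hF, ⟨z₀, hz₀⟩, hle⟩ :=
    exists_norm_sq_add_norm_sq_le_one (clark_mem_contractiveAnalytic lam) h
  have hmem (z : 𝔻) : (z : ℂ) ∈ Metric.ball 0 1 := mem_ball_zero_iff.2 z.norm_lt_one
  refine ⟨fun z => F z * (herglotzC lam z + 1) / 2,
    (hF.mul ((differentiableOn_herglotzC lam).add_const 1)).div_const 2, ⟨z₀, hmem z₀, ?_⟩,
    fun z hz => ?_⟩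
  · exact div_ne_zero (mul_ne_zero hz₀ (herglotzC_add_one_ne_zero lam (hmem z₀))) two_ne_zero
  · have hne := herglotzC_add_one_ne_zero lam hz
    have hF1 : ‖F z‖ ^ 2 ≤ 4 * (herglotzC lam z).re / ‖herglotzC lam z + 1‖ ^ 2 := by
      have := hle (.mk z (mem_ball_zero_iff.1 hz))
      rw [clark, herglotz_eq_herglotzC, Complex.UnitDisc.coe_mk] at this
      rw [← one_sub_norm_sq_cayley hne]
      exact le_sub_iff_add_le'.2 this
    rw [le_div_iff₀ (by positivity)] at hF1
    rw [norm_div, norm_mul, div_pow, mul_pow, Complex.norm_ofNat]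
    linarith

theorem circleAverage_mul_re_herglotzC {u : ℂ → ℝ}
    (hu : InnerProductSpace.HarmonicOnNhd u (Metric.closedBall 0 1)) {r : ℝ} (hr : |r| < 1) :
    Real.circleAverage (fun z => u z * (herglotzC lam (r • z)).re) 0 1 =
      ∫ ζ : Circle, u (r • (ζ : ℂ)) ∂lam := by
  have hmem {z : ℂ} (hz : ‖z‖ = 1) : r • z ∈ Metric.ball (0 : ℂ) 1 := by
    rwa [mem_ball_zero_iff, norm_smul, hz, mul_one]
  have hsymm {z w : ℂ} (hz : ‖z‖ = 1) (hw : ‖w‖ = 1) :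
      poissonKernel 0 (r • z) w = poissonKernel 0 (r • w) z := by
    simp only [poissonKernel, sub_zero, norm_smul, hz, hw, norm_sub_smul_comm (hw.trans hz.symm)]
  have hcont : ContinuousOn (fun p : ℂ × Circle => u p.1 * poissonKernel 0 (r • (p.2 : ℂ)) p.1)
      (Metric.sphere 0 |1| ×ˢ Set.univ) := by
    refine (hu.continuousOn.comp continuousOn_fst fun p hp => ?_).mul
      (ContinuousOn.div (by fun_prop) (by fun_prop) fun p hp => ?_)
    · rw [abs_one] at hp
      exact Metric.sphere_subset_closedBall hp.1
    · rw [sub_zero, sub_zero]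
      refine pow_ne_zero 2 (norm_ne_zero_iff.2 (sub_ne_zero.2 ?_))
      rw [abs_one] at hp
      intro heq
      exact Metric.sphere_disjoint_ball.notMem_of_mem_left hp.1 (heq ▸ hmem p.2.norm_coe)
  calc Real.circleAverage (fun z => u z * (herglotzC lam (r • z)).re) 0 1
      = Real.circleAverage (fun z => ∫ ζ : Circle, u z * poissonKernel 0 (r • (ζ : ℂ)) z ∂lam)
          0 1 := by
        refine Real.circleAverage_congr_sphere fun z hz => ?_
        rw [abs_one, mem_sphere_zero_iff_norm] at hz
        simp only [re_herglotzC lam (hmem hz), hsymm hz (Circle.norm_coe _), integral_const_mul]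
    _ = ∫ ζ : Circle,
          Real.circleAverage (fun z => u z * poissonKernel 0 (r • (ζ : ℂ)) z) 0 1 ∂lam :=
        circleAverage_integral_swap hcont
    _ = ∫ ζ : Circle, u (r • (ζ : ℂ)) ∂lam := by
        refine integral_congr_ae (.of_forall fun ζ => ?_)
        beta_reduce
        rw [← hu.circleAverage_poissonKernel_smul (hmem ζ.norm_coe)]
        simp only [mul_comm (u _), ← smul_eq_mul, Pi.smul_def']

theorem norm_sq_le_integral_of_le_mul_re_herglotzC {f : ℂ → ℂ} {u : ℂ → ℝ}
    (hf : DiffContOnCl ℂ f (Metric.ball 0 1))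
    (hu : InnerProductSpace.HarmonicOnNhd u (Metric.closedBall 0 1)) {r : ℝ} (hr : |r| < 1)
    (hle : ∀ z ∈ Metric.sphere 0 1, ‖f z‖ ^ 2 ≤ u z * (herglotzC lam (r • z)).re) :
    ‖f 0‖ ^ 2 ≤ ∫ ζ : Circle, u (r • (ζ : ℂ)) ∂lam := by
  have hmem : Set.MapsTo (fun z : ℂ => r • z) (Metric.sphere 0 1) (Metric.ball 0 1) := by
    intro z hz
    rwa [mem_ball_zero_iff, norm_smul, mem_sphere_zero_iff_norm.1 hz, mul_one]
  have hfc : ContinuousOn f (Metric.sphere 0 1) :=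
    hf.continuousOn_ball.mono Metric.sphere_subset_closedBall
  have hHc : ContinuousOn (fun z : ℂ => (herglotzC lam (r • z)).re) (Metric.sphere 0 1) :=
    Complex.continuous_re.comp_continuousOn
      ((differentiableOn_herglotzC lam).continuousOn.comp (by fun_prop) hmem)
  have huc : ContinuousOn u (Metric.sphere 0 1) :=
    hu.continuousOn.mono Metric.sphere_subset_closedBall
  calc ‖f 0‖ ^ 2 ≤ Real.circleAverage (fun z => ‖f z‖ ^ 2) 0 1 :=
        norm_sq_le_circleAverage_norm_sq (by rwa [abs_one])
    _ ≤ Real.circleAverage (fun z => u z * (herglotzC lam (r • z)).re) 0 1 :=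
        Real.circleAverage_mono ((hfc.norm.pow 2).circleIntegrable zero_le_one)
          ((huc.mul hHc).circleIntegrable zero_le_one) (by rwa [abs_one])
    _ = ∫ ζ : Circle, u (r • (ζ : ℂ)) ∂lam := circleAverage_mul_re_herglotzC lam hu hr

theorem norm_sq_pow_mul_eval_zero_le {k : ℕ} {F : ℂ → ℂ}
    (hF : DifferentiableOn ℂ F (Metric.ball 0 1))
    (hle : ∀ z ∈ Metric.ball 0 1, ‖z ^ k * F z‖ ^ 2 ≤ (herglotzC lam z).re) {q Q : ℂ[X]}
    (hQ : ∀ z : ℂ, ‖z‖ = 1 → (Q.eval z).re = ‖q.eval z‖ ^ 2) {r : ℝ} (hr : |r| < 1) :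
    ‖(r : ℂ) ^ k * (q.eval 0 * F 0)‖ ^ 2 ≤ ∫ ζ : Circle, (Q.eval (r • (ζ : ℂ))).re ∂lam := by
  have hmem : Set.MapsTo (fun z : ℂ => r • z) (Metric.closedBall 0 1) (Metric.ball 0 1) := by
    intro z hz
    rw [mem_closedBall_zero_iff] at hz
    rw [mem_ball_zero_iff, norm_smul]
    exact (mul_le_of_le_one_right (norm_nonneg r) hz).trans_lt hr
  have hdiff : DifferentiableOn ℂ (fun z => (r : ℂ) ^ k * (q.eval z * F (r • z)))
      (Metric.closedBall 0 1) :=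
    (q.differentiable.differentiableOn.mul (hF.comp (by fun_prop) hmem)).const_mul _
  have hre : InnerProductSpace.HarmonicOnNhd (fun z => (Q.eval z).re) (Metric.closedBall 0 1) :=
    fun z _ => (Q.differentiable.analyticAt z).harmonicAt_re
  have hmul := norm_sq_le_integral_of_le_mul_re_herglotzC lam
    (hdiff.mono Metric.closure_ball_subset_closedBall).diffContOnCl hre hr fun z hz => ?_
  · simpa only [smul_zero] using hmul
  · have hz1 := mem_sphere_zero_iff_norm.1 hz
    calc ‖(r : ℂ) ^ k * (q.eval z * F (r • z))‖ ^ 2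
        = ‖q.eval z‖ ^ 2 * ‖(r • z) ^ k * F (r • z)‖ ^ 2 := by
          simp only [norm_mul, norm_pow, norm_smul, hz1, Complex.norm_real]
          ring
      _ ≤ (Q.eval z).re * (herglotzC lam (r • z)).re := by
          rw [hQ z hz1]
          gcongr
          exact hle _ (hmem (Metric.sphere_subset_closedBall hz))

theorem norm_sq_eval_zero_mul_le {k : ℕ} {F : ℂ → ℂ}
    (hF : DifferentiableOn ℂ F (Metric.ball 0 1))
    (hle : ∀ z ∈ Metric.ball 0 1, ‖z ^ k * F z‖ ^ 2 ≤ (herglotzC lam z).re) (q : ℂ[X]) :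
    ‖q.eval 0 * F 0‖ ^ 2 ≤ ∫ ζ : Circle, ‖q.eval (ζ : ℂ)‖ ^ 2 ∂lam := by
  obtain ⟨Q, hQ⟩ := exists_re_eval_eq_norm_sq q
  have hcont : Continuous fun r : ℝ => ∫ ζ : Circle, (Q.eval (r • (ζ : ℂ))).re ∂lam := by
    have := continuous_circle_coe
    simpa using continuous_parametric_integral_of_continuous (μ := lam) (s := Set.univ)
      (f := fun (r : ℝ) (ζ : Circle) => (Q.eval (r • (ζ : ℂ))).re) (by fun_prop) isCompact_univ
  have hone : (1 : ℝ) ∈ closure (Set.Ioo (-1) 1) := by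
    rw [closure_Ioo (by norm_num)]
    simp
  have hlim := (isClosed_le (by fun_prop) hcont).closure_subset_iff.2
    (fun r hr => norm_sq_pow_mul_eval_zero_le lam hF hle hQ (abs_lt.2 hr)) hone
  simpa only [Set.mem_ofPred_eq, Complex.ofReal_one, one_pow, one_mul, one_smul,
    hQ _ (Circle.norm_coe _)] using hlim

theorem norm_sq_polyLp (q : ℂ[X]) :
    ‖polyLp lam q‖ ^ 2 = ∫ ζ : Circle, ‖q.eval (ζ : ℂ)‖ ^ 2 ∂lam := by
  have haeval (ζ : Circle) : aeval zeta q ζ = q.eval (ζ : ℂ) := by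
    simp [zeta_apply]
  have hinner : ⟪polyLp lam q, polyLp lam q⟫_ℂ = ∫ ζ : Circle, (‖q.eval (ζ : ℂ)‖ : ℂ) ^ 2 ∂lam := by
    refine (ContinuousMap.inner_toLp lam (aeval zeta q) (aeval zeta q)).trans ?_
    simp only [haeval, RCLike.mul_conj, Complex.coe_algebraMap]
  rw [inner_self_eq_norm_sq_to_K] at hinner
  refine Complex.ofReal_injective ?_
  rw [Complex.ofReal_pow, ← integral_complex_ofReal]
  simp only [Complex.ofReal_pow]
  exact hinner

variable {lam}

theorem containsConst_of_eval_zero {c : ℝ} (hc : 0 < c)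
    (h : ∀ q : ℂ[X], c * ‖q.eval 0‖ ^ 2 ≤ ‖polyLp lam q‖ ^ 2) : ContainsConst lam := by
  let K : Submodule ℂ (Lp ℂ 2 lam) := LinearMap.range (polyLp lam ∘ₗ LinearMap.mulLeft ℂ X)
  have hdist : ∀ x ∈ K.topologicalClosure, c ≤ ‖polyLp lam 1 - x‖ ^ 2 := by
    have hclosed : IsClosed {x | c ≤ ‖polyLp lam 1 - x‖ ^ 2} :=
      isClosed_le continuous_const (by fun_prop)
    refine hclosed.closure_subset_iff.2 ?_
    rintro _ ⟨p, rfl⟩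
    have hp := h (1 - X * p)
    rw [map_sub] at hp
    simpa using hp
  have hone : polyLp lam 1 ∉ K.topologicalClosure := fun hmem => by
    have := hdist _ hmem
    rw [sub_self, norm_zero, zero_pow two_ne_zero] at this
    exact this.not_gt hc
  obtain ⟨k, hk, hinner⟩ := exists_mem_orthogonal_inner_eq_one hone
  refine containsConst_iff.2 ⟨k, ?_, fun n => ?_⟩
  · rw [fourierCoeffLp_apply, ← hinner, ← pow_zero X, polyLp_X_pow, Nat.cast_zero]
  · rw [fourierCoeffLp_apply, ← Nat.cast_add_one, ← polyLp_X_pow]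
    have hmem : polyLp lam (X ^ (n + 1)) ∈ K := ⟨X ^ n, by simp [pow_succ']⟩
    exact Submodule.inner_right_of_mem_orthogonal hmem hk

theorem containsConst_of_not_isExtremeMeasure (h : ¬ IsExtremeMeasure lam) :
    ContainsConst lam := by
  obtain ⟨G, hG, hne, hle⟩ := exists_norm_sq_le_re_herglotzC lam h
  obtain ⟨k, F, hF, hF0, hGF⟩ := exists_eq_pow_smul_of_differentiableOn Metric.isOpen_ball
    (convex_ball (0 : ℂ) 1).isPreconnected (Metric.mem_ball_self one_pos) hG hne
  simp only [sub_zero, smul_eq_mul] at hGF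
  refine containsConst_of_eval_zero (c := ‖F 0‖ ^ 2) (by positivity) fun q => ?_
  rw [norm_sq_polyLp, mul_comm, ← mul_pow, ← norm_mul]
  exact norm_sq_eval_zero_mul_le lam hF (fun z hz => hGF z ▸ hle z hz) q

end Herglotz

end CauchyTransform

end

theorem theorem5p5 (μ lam : Measure Circle) [IsFiniteMeasure μ] [IsFiniteMeasure lam] :
    (¬ IsExtremeMeasure lam → IsReducing (V μ) (intSpace μ lam)) ∧
    (IsReducing (V μ) (intSpace μ lam) →
      ∀ (μac μs : Measure Circle) [IsFiniteMeasure μac] [IsFiniteMeasure μs],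
        μ = μac + μs → μac ≪ lam → μs ⟂ₘ lam →
        (∃ (e : HPlus μac →ₗᵢ[ℂ] HPlus μ) (j : HPlus μs →ₗᵢ[ℂ] HPlus μ),
          IsInclusion e ∧ IsInclusion j ∧
          LinearMap.range e.toLinearMap ⟂ LinearMap.range j.toLinearMap ∧
          LinearMap.range e.toLinearMap ⊔ LinearMap.range j.toLinearMap = ⊤ ∧
          LinearMap.range e.toLinearMap = (intSpace μ lam).topologicalClosure) ∧
        RKSingular μs lam ∧
        RKAbsolutelyContinuous μac lam ∧
        (∀ (γ : Measure Circle) [IsFiniteMeasure γ],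
          γ ≤ μ → RKAbsolutelyContinuous γ lam → γ ≤ μac)) := by
  refine ⟨fun h => isReducing_intSpace_of_containsConst
    (containsConst_of_not_isExtremeMeasure h), fun hred μac μs _ _ hμ hac hs => ?_⟩
  obtain ⟨E, hE, hE0, rfl, rfl⟩ := exists_eq_restrict_of_mutuallySingular hμ hac hs
  have hinv := indicatorLp_mem_H2_of_isReducing hred hE hE0 hac
  have hcompl := indicatorLp_compl_mem_H2 hE hinv
  have hrk := rkAbsolutelyContinuous_of_absolutelyContinuous hac
  have hle := intSpace_le_intSpace_restrict hred hE hE0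
  have horth := isOrtho_intSpace_restrict hE hinv
  obtain ⟨e, he⟩ := exists_isInclusion_restrict hE hinv
  obtain ⟨j, hj⟩ := exists_isInclusion_restrict hE.compl hcompl
  have hre := range_of_isInclusion he
  have hrj := range_of_isInclusion hj
  refine ⟨⟨e, j, he, hj, by rwa [hre, hrj], ?_,
    range_eq_topologicalClosure_intSpace he hrk (hle.trans hre.ge)⟩,
    rkSingular_of_isOrtho_range hj (hrj ▸ horth.mono_left hle), hrk, fun γ _ hγ hγrk => ?_⟩
  · rw [hre, hrj, intSpace_restrict_sup_intSpace_restrict_compl hE]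
  · have hγE : γ Eᶜ = 0 := measure_eq_zero_of_rkAbsolutelyContinuous ENNReal.one_ne_top
      (by rwa [one_smul]) hred hγrk hE.compl hE0 hcompl
    rw [← Measure.restrict_eq_self_of_ae_mem hγE]
    exact Measure.restrict_mono_measure hγ E
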